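/- Let $n\ge 1$ and let $q\in\mathbb{C}$ with $0<|q|<1$. For a partition $\lambda=(\lambda_1\ge\lambda_2\ge\cdots\ge 0)$ let $|\lambda|=\sum_i\lambda_i$, put $(q;q)_\infty=\prod_{k\ge1}(1-q^k)$, and for a function $f$ on the set of all partitions let $$\langle f\rangle_q=(q;q)_\infty\sum_\lambda f(\lambda)\,q^{|\lambda|}$$ whenever the series converges. The $n$-point function is $$F(t_1,\dots,t_n)=\Big\langle \prod_{k=1}^n\sum_{i=1}^\infty t_k^{\lambda_i-i+\frac12}\Big\rangle_q .$$ Let $$\Theta(x)=\sum_{m\in\mathbb{Z}}(-1)^m q^{\frac{(m+1/2)^2}{2}}x^{m+\frac12},\qquad \Theta^{(k)}(x)=\Big(x\frac{d}{dx}\Big)^k\Theta(x).$$ Here an eighth root $q^{1/8}$ of $q$ is fixed, square roots $t_k^{1/2}$ are chosen, and the square root of a product $t_{i_1}\cdots t_{i_r}$ is the product of the chosen square roots (so all functions are single-valued functions of $t_1^{1/2},\dots,t_n^{1/2}$). Then: (1) If $|t_k|>1$ for all $k$ and $|t_1\cdots t_n|<|q|^{-1}$, the series defining $F$ converge absolutely,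 the denominators below do not vanish, and $$F(t_1,\dots,t_n)=\sum_{\sigma\in S(n)}\frac{\det\left(\dfrac{\Theta^{(j-i+1)}(t_{\sigma(1)}\cdots t_{\sigma(n-j)})}{(j-i+1)!}\right)_{i,j=1}^n}{\Theta(t_{\sigma(1)})\,\Theta(t_{\sigma(1)}t_{\sigma(2)})\cdots\Theta(t_{\sigma(1)}\cdots t_{\sigma(n)})},$$ where $\sigma$ runs through all permutations of $\{1,\dots,n\}$ and $1/(-m)!=0$ for $m\ge1$ (so the entries with $j-i+1<0$ are $0$). (2) The right-hand side is a meromorphic function of $(t_1^{1/2},\dots,t_n^{1/2})\in(\mathbb{C}\setminus\{0\})^n$, so it is a meromorphic continuation of $F$; and every meromorphic continuation of $F$ to $(\mathbb{C}\setminus\{0\})^n$ equals it at every point at which the continuation is analytic and none of the denominators vanishes. -/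

import Mathlib

open scoped Topology

noncomputable section

namespace BlochOkounkov

/-- The `q`-Pochhammer symbol `(q;q)_∞ = (1-q)(1-q²)(1-q³)⋯`. -/
def qPoch (q : ℂ) : ℂ := ∏' k : ℕ, (1 - q ^ (k + 1))

/-- The terms of the series `∑_λ f(λ) q^{|λ|}` over all partitions `λ` (Young diagrams). -/
def avgTerm (q : ℂ) (f : YoungDiagram → ℂ) (lam : YoungDiagram) : ℂ :=
  f lam * q ^ lam.card

/-- The average `⟨f⟩_q = (q;q)_∞ ∑_λ f(λ) q^{|λ|}`. -/
def avg (q : ℂ) (f : YoungDiagram → ℂ) : ℂ :=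
  qPoch q * ∑' lam : YoungDiagram, avgTerm q f lam

/-- With `t = s²`, the term `t^{λ_i - i + 1/2} = s^{2(λ_i - i) + 1}`. The rows of a Young diagram are
numbered from `0` in Mathlib, so `i : ℕ` here stands for the row number `i + 1`. -/
def rowTerm (s : ℂ) (lam : YoungDiagram) (i : ℕ) : ℂ :=
  s ^ (2 * ((lam.rowLen i : ℤ) - ((i : ℤ) + 1)) + 1)

/-- The function `λ ↦ ∏_k ∑_{i ≥ 1} t_k^{λ_i - i + 1/2}`, where `t_k = s_k²`. -/
def nPointFun {n : ℕ} (s : Fin n → ℂ) (lam : YoungDiagram) : ℂ :=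
  ∏ k : Fin n, ∑' i : ℕ, rowTerm (s k) lam i

/-- The series for the `n`-point function
`F(t_1,…,t_n) = ⟨∏_k ∑_{i ≥ 1} t_k^{λ_i - i + 1/2}⟩_q`, where `t_k = s_k²`. -/
def nPoint {n : ℕ} (q : ℂ) (s : Fin n → ℂ) : ℂ := avg q (nPointFun s)

/-- The domain `|t_k| > 1`, `|t_1 ⋯ t_n| < |q|⁻¹` of convergence, where `t_k = s_k²`. -/
def convDomain (n : ℕ) (q : ℂ) : Set (Fin n → ℂ) :=
  {s | (∀ k, 1 < ‖s k ^ 2‖) ∧ ‖∏ k, s k ^ 2‖ < ‖q‖⁻¹}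

/-- The theta function `Θ(x) = ∑_{m ∈ ℤ} (-1)^m q^{(m+1/2)²/2} x^{m+1/2}`, where `x = s²` and
`q = κ⁸`: note `(m+1/2)²/2 = (2m+1)²/8`. -/
def theta (κ s : ℂ) : ℂ :=
  ∑' m : ℤ, (-1 : ℂ) ^ m * κ ^ ((2 * m + 1) ^ 2) * s ^ (2 * m + 1)

/-- The operator `x d/dx` in the coordinate `s`, where `x = s²`. -/
def eulerOp (f : ℂ → ℂ) : ℂ → ℂ := fun s => s / 2 * deriv f s

/-- `Θ^{(k)}(x) = (x d/dx)^k Θ(x)`, where `x = s²` and `q = κ⁸`. -/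
def thetaDeriv (κ : ℂ) (k : ℕ) : ℂ → ℂ := eulerOp^[k] (theta κ)

/-- The square root `s_{σ(1)} ⋯ s_{σ(m)}` of `t_{σ(1)} ⋯ t_{σ(m)}`. -/
def partialProd {n : ℕ} (σ : Equiv.Perm (Fin n)) (s : Fin n → ℂ) (m : ℕ) : ℂ :=
  ∏ l ∈ Finset.univ.filter (fun l : Fin n => (l : ℕ) < m), s (σ l)

/-- The `n × n` matrix with entries `Θ^{(j-i+1)}(t_{σ(1)} ⋯ t_{σ(n-j)}) / (j-i+1)!`, which are `0`
if `j - i + 1 < 0`. The difference `j - i` is the same for indices counted from `0` or from `1`;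
the index `j` of the formula is `j + 1` here. -/
def thetaMatrix {n : ℕ} (κ : ℂ) (s : Fin n → ℂ) (σ : Equiv.Perm (Fin n)) :
    Matrix (Fin n) (Fin n) ℂ :=
  Matrix.of fun i j =>
    if (i : ℕ) ≤ (j : ℕ) + 1 then
      thetaDeriv κ ((j : ℕ) + 1 - (i : ℕ)) (partialProd σ s (n - ((j : ℕ) + 1))) /
        (Nat.factorial ((j : ℕ) + 1 - (i : ℕ)) : ℂ)
    else 0

/-- `Θ(t_{σ(1)}) Θ(t_{σ(1)} t_{σ(2)}) ⋯ Θ(t_{σ(1)} ⋯ t_{σ(n)})`. -/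
def thetaDenom {n : ℕ} (κ : ℂ) (s : Fin n → ℂ) (σ : Equiv.Perm (Fin n)) : ℂ :=
  ∏ m : Fin n, theta κ (partialProd σ s ((m : ℕ) + 1))

/-- The sum over permutations of the quotients of determinants by products of theta functions. -/
def thetaSum {n : ℕ} (κ : ℂ) (s : Fin n → ℂ) : ℂ :=
  ∑ σ : Equiv.Perm (Fin n), (thetaMatrix κ s σ).det / thetaDenom κ s σ

/-- The set `(ℂ \ {0})ⁿ`. -/
def torus (n : ℕ) : Set (Fin n → ℂ) := {s | ∀ k, s k ≠ 0}

/-- A function of several complex variables is meromorphic on `U` if near each point of `U` it is a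
quotient `g / h` of analytic functions, `h` not identically zero, at the points with `h ≠ 0`
(its values on the zero set of `h` are immaterial). -/
def IsMeromorphicOn {n : ℕ} (f : (Fin n → ℂ) → ℂ) (U : Set (Fin n → ℂ)) : Prop :=
  ∀ p ∈ U, ∃ g h : (Fin n → ℂ) → ℂ, AnalyticAt ℂ g p ∧ AnalyticAt ℂ h p ∧
    (¬ ∀ᶠ x in 𝓝 p, h x = 0) ∧ ∀ᶠ x in 𝓝 p, h x ≠ 0 → f x = g x / h x

end BlochOkounkov

end

noncomputable section

namespace BlochOkounkov

/-! Pair a partition λ with an integer charge c. The pair is a Maya diagram: the set of occupied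
sites λ_i - i + c, i ≥ 0. Give it the weight (-1)^c q^{(c+1/2)²/2 + |λ|}, so that summing over c
produces Θ and its derivatives, while summing over λ produces correlation functions. Occupying an
empty site a multiplies the weight by -q^a (`stateWeight_occupy`) and adds t^a to the sum of t^b
over the occupied sites b (`rowSum_occupy`). For a = 0 the weight changes sign, while c + 1/2 minus
that sum is unchanged, both parts growing by 1. Hence the weighted sum of the product of these
differences over k ∈ N cancels in pairs. Expanding the product gives `sum_thetaDeriv_mul_corr`: ∑_{M
⊆ N} (-1)^{|M|} Θ^{(|N|-|M|)}(t_M) F(M) = 0, where t_M = ∏_{k ∈ M} t_k and F(M) is the correlation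
function of the variables in M.

For N nonempty, Θ(t_N) ≠ 0 on the domain (`theta_ne_zero`, through Jacobi's triple product), so
these relations determine F recursively from F(∅) = 1. For a fixed ordering of the variables, the
analogous recursion along the chain of initial sets, with coefficients Θ^{(k)}/k!, is triangular,
and `det_hessenberg` solves it by the determinant in the formula. Summing over orderings turns
chains into subsets, as the k! orderings of a difference N \ M of size k cancel 1/k!
(`sum_triangularSol`).

Numerators and denominators are analytic on the connected torus, so uniqueness of the continuation
is an identity theorem for quotients (`mul_eq_of_eq_on_open`). -/

/-! ### Young diagrams as antitone sequences of row lengths -/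

theorem exists_youngDiagram_rowLen (f : ℕ → ℕ) (hf : Antitone f) (hK : ∃ K, f K = 0) :
    ∃ lam : YoungDiagram, ∀ i, lam.rowLen i = f i := by
  obtain ⟨K, hK⟩ := hK
  let lam : YoungDiagram :=
    { cells := (Finset.range K ×ˢ Finset.range (f 0)).filter (fun c => c.2 < f c.1)
      isLowerSet := by
        rintro ⟨i, j⟩ ⟨i', j'⟩ ⟨h1, h2⟩ h
        simp only [Finset.coe_filter, Finset.mem_product, Finset.mem_range, Set.mem_ofPred_eq]
          at h h1 h2 ⊢
        have := hf h1
        omega }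
  have hmem (i j : ℕ) : (i, j) ∈ lam ↔ j < f i := by
    rw [← YoungDiagram.mem_cells]
    simp only [lam, Finset.mem_filter, Finset.mem_product, Finset.mem_range]
    refine ⟨fun h => h.2, fun h => ⟨⟨?_, ?_⟩, h⟩⟩
    · by_contra! hi
      have := hf hi
      omega
    · have := hf (Nat.zero_le i)
      omega
  refine ⟨lam, fun i => ?_⟩
  have h (j : ℕ) : j < lam.rowLen i ↔ j < f i := by
    rw [← YoungDiagram.mem_iff_lt_rowLen, hmem]
  have h1 := h (lam.rowLen i)
  have h2 := h (f i)
  omega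

theorem youngDiagram_ext {lam mu : YoungDiagram} (h : ∀ i, lam.rowLen i = mu.rowLen i) :
    lam = mu := by
  ext ⟨i, j⟩
  rw [YoungDiagram.mem_cells, YoungDiagram.mem_cells, YoungDiagram.mem_iff_lt_rowLen,
    YoungDiagram.mem_iff_lt_rowLen, h]

theorem exists_rowLen_eq_zero (lam : YoungDiagram) : ∃ K, lam.rowLen K = 0 := by
  refine ⟨lam.colLen 0, ?_⟩
  by_contra h
  have : (lam.colLen 0, 0) ∈ lam := YoungDiagram.mem_iff_lt_rowLen.2 (Nat.pos_of_ne_zero h)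
  exact lt_irrefl _ (YoungDiagram.mem_iff_lt_colLen.1 this)

theorem rowLen_eq_zero_of_le {lam : YoungDiagram} {K i : ℕ} (hK : lam.rowLen K = 0) (h : K ≤ i) :
    lam.rowLen i = 0 := by
  have := lam.rowLen_anti K i h
  omega

theorem card_eq_sum_rowLen {lam : YoungDiagram} {K : ℕ} (hK : lam.rowLen K = 0) :
    lam.card = ∑ i ∈ Finset.range K, lam.rowLen i := by
  have hm : ∀ c ∈ lam.cells, c.1 ∈ Finset.range K := by
    rintro ⟨i, j⟩ hc
    rw [Finset.mem_range]
    by_contra! h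
    have h1 : lam.rowLen i = 0 := rowLen_eq_zero_of_le hK h
    have h2 : j < lam.rowLen i := YoungDiagram.mem_iff_lt_rowLen.1 ((YoungDiagram.mem_cells _).1 hc)
    omega
  rw [YoungDiagram.card, Finset.card_eq_sum_card_fiberwise hm]
  refine Finset.sum_congr rfl fun i _ => ?_
  rw [YoungDiagram.rowLen_eq_card]
  rfl

/-! ### Charged partitions as Maya diagrams -/

/-- The strictly decreasing sequence of occupied sites of the state of charge `x.1` with
partition `x.2`. -/
def site (x : ℤ × YoungDiagram) (i : ℕ) : ℤ := x.2.rowLen i - i + x.1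

/-- The set of occupied sites. -/
def maya (x : ℤ × YoungDiagram) : Set ℤ := Set.range (site x)

theorem site_strictAnti (x : ℤ × YoungDiagram) : StrictAnti (site x) := by
  intro i j h
  have := x.2.rowLen_anti i j h.le
  simp only [site]
  omega

/-- A set of integers has at most one strictly decreasing enumeration, and far down, where all rows
are empty, the enumeration reveals the charge. -/
theorem maya_injective : Function.Injective maya := by
  intro x y h
  have h1 : (fun i => -site x i) = fun i => -site y i := by
    rw [← StrictMono.range_inj (fun i j hij => neg_lt_neg (site_strictAnti x hij))
      (fun i j hij => neg_lt_neg (site_strictAnti y hij))]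
    have : ∀ z, Set.range (fun i => -site z i) = (fun a => -a) '' maya z := by
      intro z
      rw [maya, ← Set.range_comp]
      rfl
    rw [this, this, h]
  have h2 (i : ℕ) : site x i = site y i := neg_injective (congrFun h1 i)
  obtain ⟨K, hK⟩ := exists_rowLen_eq_zero x.2
  obtain ⟨K', hK'⟩ := exists_rowLen_eq_zero y.2
  have h3 : x.1 = y.1 := by
    have := h2 (max K K')
    simp only [site, rowLen_eq_zero_of_le hK (le_max_left K K'),
      rowLen_eq_zero_of_le hK' (le_max_right K K')] at this
    omega
  refine Prod.ext h3 (youngDiagram_ext fun i => ?_)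
  have := h2 i
  simp only [site] at this
  omega

theorem exists_maya_eq_insert (a : ℤ) (x : ℤ × YoungDiagram) (ha : a ∉ maya x) :
    ∃ y, maya y = insert a (maya x) ∧ y.1 = x.1 + 1 ∧
      (y.2.card : ℤ) = x.2.card - x.1 + a - 1 := by
  obtain ⟨c, lam⟩ := x
  have hne (j : ℕ) : (lam.rowLen j : ℤ) - j + c ≠ a := fun h => ha ⟨j, h⟩
  obtain ⟨K₀, hK₀⟩ := exists_rowLen_eq_zero lam
  have hex : ∃ i : ℕ, (lam.rowLen i : ℤ) - i + c < a := by
    refine ⟨max K₀ (c - a + 1).toNat, ?_⟩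
    have h1 := rowLen_eq_zero_of_le hK₀ (le_max_left K₀ (c - a + 1).toNat)
    have h2 := le_max_right K₀ (c - a + 1).toNat
    omega
  classical
  -- `i` counts the occupied sites above `a`; the new site takes position `i` in the enumeration.
  let i := Nat.find hex
  have hi : (lam.rowLen i : ℤ) - i + c < a := Nat.find_spec hex
  have hlt (j : ℕ) (hj : j < i) : a < (lam.rowLen j : ℤ) - j + c :=
    lt_of_le_of_ne (not_lt.1 (Nat.find_min hex hj)) (hne j).symm
  have hpos (j : ℕ) (hj : j < i) : (i : ℤ) - c + a ≤ lam.rowLen j := by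
    have h1 := hlt (i - 1) (by omega)
    have h2 := lam.rowLen_anti j (i - 1) (by omega)
    omega
  -- The charge rises by 1, so the rows before `i` lose a cell to keep their sites; the later rows
  -- move down one index, which absorbs the change of charge.
  let f : ℕ → ℕ := fun j => if j < i then lam.rowLen j - 1 else
    if j = i then ((i : ℤ) - c + a - 1).toNat else lam.rowLen (j - 1)
  have hf : Antitone f := by
    refine antitone_nat_of_succ_le fun j => ?_
    have hj := lam.rowLen_anti j (j + 1) (by omega)
    simp only [f]
    rcases lt_trichotomy (j + 1) i with h | h | h
    · rw [if_pos h, if_pos (by omega)]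
      omega
    · rw [if_neg (by omega), if_pos h, if_pos (by omega)]
      have := hpos j (by omega)
      omega
    · rw [if_neg (by omega), if_neg (by omega), if_neg (by omega)]
      split_ifs with h'
      · rw [Nat.add_sub_cancel, h']
        omega
      · rw [Nat.add_sub_cancel]
        exact lam.rowLen_anti _ _ (by omega)
  let K := K₀ + i + 1
  have hK : lam.rowLen K = 0 := rowLen_eq_zero_of_le hK₀ (by omega)
  have hfK : f (K + 1) = 0 := by
    simp only [f]
    rw [if_neg (by omega), if_neg (by omega)]
    exact rowLen_eq_zero_of_le hK₀ (by omega)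
  obtain ⟨mu, hmu⟩ := exists_youngDiagram_rowLen f hf ⟨_, hfK⟩
  have hs1 (j : ℕ) (hj : j < i) : site (c + 1, mu) j = site (c, lam) j := by
    have := hpos j hj
    simp only [site, hmu, f, if_pos hj]
    omega
  have hs2 : site (c + 1, mu) i = a := by
    simp only [site, hmu, f, lt_irrefl, if_false, if_true]
    omega
  have hs3 (j : ℕ) (hj : i ≤ j) : site (c + 1, mu) (j + 1) = site (c, lam) j := by
    simp only [site, hmu, f, if_neg (show ¬ j + 1 < i by omega),
      if_neg (show ¬ j + 1 = i by omega), Nat.add_sub_cancel]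
    push_cast
    ring
  refine ⟨(c + 1, mu), ?_, rfl, ?_⟩
  · ext b
    constructor
    · rintro ⟨j, rfl⟩
      rcases lt_trichotomy j i with h | h | h
      · exact Or.inr ⟨j, (hs1 j h).symm⟩
      · rw [h]
        exact Or.inl hs2
      · obtain ⟨j, rfl⟩ : ∃ j', j = j' + 1 := ⟨j - 1, by omega⟩
        exact Or.inr ⟨j, (hs3 j (by omega)).symm⟩
    · rintro (rfl | ⟨j, rfl⟩)
      · exact ⟨i, hs2⟩
      · rcases lt_or_ge j i with h | h
        · exact ⟨j, hs1 j h⟩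
        · exact ⟨j + 1, hs3 j h⟩
  -- The first `i` rows lose `i` cells in total and the new row has `i - c + a - 1` cells, so the
  -- size changes by `a - c - 1`, independently of `i`.
  · have key (m : ℕ) : (∑ j ∈ Finset.range (i + m + 1), (f j : ℤ)) =
        (∑ j ∈ Finset.range (i + m), (lam.rowLen j : ℤ)) - c + a - 1 := by
      induction m with
      | zero =>
        have h1 : ∑ j ∈ Finset.range i, (f j : ℤ) =
            ∑ j ∈ Finset.range i, ((lam.rowLen j : ℤ) - 1) := by
          refine Finset.sum_congr rfl fun j hj => ?_
          have hj := Finset.mem_range.1 hj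
          have := hpos j hj
          simp only [f, if_pos hj]
          omega
        simp only [Nat.add_zero]
        rw [Finset.sum_range_succ, h1, Finset.sum_sub_distrib]
        simp only [f, lt_irrefl, if_false, if_true, Finset.sum_const, Finset.card_range]
        simp only [nsmul_eq_mul, mul_one]
        omega
      | succ m ih =>
        rw [← add_assoc i m 1, Finset.sum_range_succ, ih, Finset.sum_range_succ _ (i + m)]
        simp only [f, if_neg (show ¬ i + m + 1 < i by omega),
          if_neg (show ¬ i + m + 1 = i by omega), Nat.add_sub_cancel]
        ring
    have hmK : mu.rowLen (K + 1) = 0 := by rw [hmu, hfK]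
    rw [card_eq_sum_rowLen hmK, card_eq_sum_rowLen hK]
    push_cast
    simp only [hmu]
    have := key (K₀ + 1)
    rw [show i + (K₀ + 1) = K by omega] at this
    exact this

/-- Needed only for the surjectivity of `occupy`, so charge and size are not tracked. -/
theorem exists_maya_eq_diff (a : ℤ) (x : ℤ × YoungDiagram) (ha : a ∈ maya x) :
    ∃ y, maya y = maya x \ {a} := by
  obtain ⟨c, lam⟩ := x
  obtain ⟨i, hi⟩ := ha
  obtain ⟨K, hK⟩ := exists_rowLen_eq_zero lam
  let f : ℕ → ℕ := fun j => if j < i then lam.rowLen j + 1 else lam.rowLen (j + 1)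
  have hf : Antitone f := by
    refine antitone_nat_of_succ_le fun j => ?_
    have h1 := lam.rowLen_anti j (j + 1) (by omega)
    have h2 := lam.rowLen_anti (j + 1) (j + 1 + 1) (by omega)
    simp only [f]
    split_ifs <;> omega
  obtain ⟨mu, hmu⟩ := exists_youngDiagram_rowLen f hf ⟨K + i, by
    simp only [f]
    rw [if_neg (by omega)]
    exact rowLen_eq_zero_of_le hK (by omega)⟩
  have hs1 (j : ℕ) (hj : j < i) : site (c - 1, mu) j = site (c, lam) j := by
    simp only [site, hmu, f, if_pos hj]
    push_cast
    ring
  have hs3 (j : ℕ) (hj : i ≤ j) : site (c - 1, mu) j = site (c, lam) (j + 1) := by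
    simp only [site, hmu, f, if_neg (not_lt.2 hj)]
    push_cast
    ring
  refine ⟨(c - 1, mu), ?_⟩
  subst hi
  have hinj := (site_strictAnti (c, lam)).injective
  ext b
  constructor
  · rintro ⟨j, rfl⟩
    rcases lt_or_ge j i with h | h
    · rw [hs1 j h]
      exact ⟨⟨j, rfl⟩, fun h' => h.ne (hinj h')⟩
    · rw [hs3 j h]
      refine ⟨⟨j + 1, rfl⟩, fun h' => ?_⟩
      have := hinj h'
      omega
  · rintro ⟨⟨j, rfl⟩, h⟩
    rcases lt_trichotomy j i with h' | h' | h'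
    · exact ⟨j, hs1 j h'⟩
    · exact absurd (by rw [h']; rfl) h
    · obtain ⟨j, rfl⟩ : ∃ j', j = j' + 1 := ⟨j - 1, by omega⟩
      exact ⟨j, hs3 j (by omega)⟩

/-- Occupying the site `a`. -/
def occupy (a : ℤ) (x : {x : ℤ × YoungDiagram // a ∉ maya x}) : {x // a ∈ maya x} :=
  ⟨(exists_maya_eq_insert a x.1 x.2).choose, by
    rw [(exists_maya_eq_insert a x.1 x.2).choose_spec.1]
    exact Set.mem_insert _ _⟩

theorem maya_occupy (a : ℤ) (x : {x : ℤ × YoungDiagram // a ∉ maya x}) :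
    maya (occupy a x).1 = insert a (maya x.1) :=
  (exists_maya_eq_insert a x.1 x.2).choose_spec.1

theorem occupy_charge (a : ℤ) (x : {x : ℤ × YoungDiagram // a ∉ maya x}) :
    (occupy a x).1.1 = x.1.1 + 1 :=
  (exists_maya_eq_insert a x.1 x.2).choose_spec.2.1

theorem occupy_card (a : ℤ) (x : {x : ℤ × YoungDiagram // a ∉ maya x}) :
    ((occupy a x).1.2.card : ℤ) = x.1.2.card - x.1.1 + a - 1 :=
  (exists_maya_eq_insert a x.1 x.2).choose_spec.2.2

theorem occupy_bijective (a : ℤ) : Function.Bijective (occupy a) := by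
  constructor
  · intro x y h
    have h1 : insert a (maya x.1) = insert a (maya y.1) := by
      rw [← maya_occupy, ← maya_occupy, h]
    refine Subtype.ext (maya_injective ?_)
    have h2 := congrArg (fun s => s \ {a}) h1
    simpa [Set.insert_sdiff_of_mem, x.2, y.2] using h2
  · intro x
    obtain ⟨y, hy⟩ := exists_maya_eq_diff a x.1 x.2
    refine ⟨⟨y, by rw [hy]; simp⟩, Subtype.ext (maya_injective ?_)⟩
    rw [maya_occupy, hy, Set.insert_sdiff_singleton, Set.insert_eq_of_mem x.2]

/-- Occupying a site, as an equivalence. -/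
def occupyEquiv (a : ℤ) : {x : ℤ × YoungDiagram // a ∉ maya x} ≃ {x // a ∈ maya x} :=
  Equiv.ofBijective _ (occupy_bijective a)

/-! ### Generating functions of partitions -/

theorem card_eq_of_rowLen_add {lam mu : YoungDiagram} {k m : ℕ} (hmu : mu.rowLen k = 0)
    (h : ∀ i, lam.rowLen i = if i ≤ k then mu.rowLen i + m else 0) :
    lam.card = mu.card + (k + 1) * m := by
  have h1 : lam.rowLen (k + 1) = 0 := by rw [h, if_neg (by omega)]
  have h2 : mu.rowLen (k + 1) = 0 := rowLen_eq_zero_of_le hmu (by omega)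
  rw [card_eq_sum_rowLen h1, card_eq_sum_rowLen h2]
  rw [Finset.sum_congr rfl (g := fun i => mu.rowLen i + m)]
  · simp [Finset.sum_add_distrib]
  · intro i hi
    rw [h, if_pos (by have := Finset.mem_range.1 hi; omega)]

theorem exists_rowLen_add (k : ℕ) (x : {lam : YoungDiagram // lam.rowLen k = 0} × ℕ) :
    ∃ lam : {lam : YoungDiagram // lam.rowLen (k + 1) = 0},
      ∀ i, lam.1.rowLen i = if i ≤ k then x.1.1.rowLen i + x.2 else 0 := by
  obtain ⟨⟨mu, hmu⟩, m⟩ := x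
  obtain ⟨lam, hlam⟩ := exists_youngDiagram_rowLen
    (fun i => if i ≤ k then mu.rowLen i + m else 0) (by
      intro i j hij
      have := mu.rowLen_anti i j hij
      dsimp only
      split_ifs <;> omega) ⟨k + 1, if_neg (by omega)⟩
  exact ⟨⟨lam, by rw [hlam, if_neg (by omega)]⟩, hlam⟩

/-- Adding `m` columns of height `k + 1` to a diagram with at most `k` rows. -/
def addColumns (k : ℕ) (x : {lam : YoungDiagram // lam.rowLen k = 0} × ℕ) :
    {lam : YoungDiagram // lam.rowLen (k + 1) = 0} :=
  (exists_rowLen_add k x).choose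

theorem rowLen_addColumns (k : ℕ) (x : {lam : YoungDiagram // lam.rowLen k = 0} × ℕ) (i : ℕ) :
    (addColumns k x).1.rowLen i = if i ≤ k then x.1.1.rowLen i + x.2 else 0 :=
  (exists_rowLen_add k x).choose_spec i

theorem addColumns_bijective (k : ℕ) : Function.Bijective (addColumns k) := by
  constructor
  · rintro ⟨⟨mu, hmu⟩, m⟩ ⟨⟨nu, hnu⟩, m'⟩ h
    have h1 (i : ℕ) : (if i ≤ k then mu.rowLen i + m else 0) =
        if i ≤ k then nu.rowLen i + m' else 0 := by
      have h2 := rowLen_addColumns k (⟨mu, hmu⟩, m) i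
      have h3 := rowLen_addColumns k (⟨nu, hnu⟩, m') i
      rw [h] at h2
      exact h2.symm.trans h3
    have hm : m = m' := by
      have := h1 k
      rw [if_pos le_rfl, if_pos le_rfl] at this
      omega
    refine Prod.ext (Subtype.ext (youngDiagram_ext fun i => ?_)) hm
    change mu.rowLen i = nu.rowLen i
    by_cases hi : i ≤ k
    · have := h1 i
      rw [if_pos hi, if_pos hi] at this
      omega
    · rw [rowLen_eq_zero_of_le hmu (by omega), rowLen_eq_zero_of_le hnu (by omega)]
  · rintro ⟨lam, hlam⟩
    obtain ⟨mu, hmu⟩ := exists_youngDiagram_rowLen (fun i => lam.rowLen i - lam.rowLen k)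
      (fun i j hij => Nat.sub_le_sub_right (lam.rowLen_anti i j hij) _) ⟨k, Nat.sub_self _⟩
    refine ⟨(⟨mu, by rw [hmu, Nat.sub_self]⟩, lam.rowLen k), Subtype.ext (youngDiagram_ext
      fun i => ?_)⟩
    rw [rowLen_addColumns]
    dsimp only
    split_ifs with hi
    · have := lam.rowLen_anti i k hi
      rw [hmu]
      omega
    · exact (rowLen_eq_zero_of_le hlam (by omega)).symm

/-- A diagram with at most `k + 1` rows is uniquely one with at most `k` rows together with some
number of columns of height `k + 1`, which contribute a geometric series in `q ^ (k + 1)`. -/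
theorem hasSum_pow_card_rows {R : Type*} [NormedField R] [CompleteSpace R] {q : R} (hq : ‖q‖ < 1)
    (k : ℕ) :
    (Summable fun lam : {lam : YoungDiagram // lam.rowLen k = 0} => ‖q ^ lam.1.card‖) ∧
    HasSum (fun lam : {lam : YoungDiagram // lam.rowLen k = 0} => q ^ lam.1.card)
      (∏ j ∈ Finset.range k, (1 - q ^ (j + 1))⁻¹) := by
  induction k with
  | zero =>
    have hbot : (⊥ : YoungDiagram).rowLen 0 = 0 := by
      by_contra h
      exact YoungDiagram.notMem_bot (0, 0)
        (YoungDiagram.mem_iff_lt_rowLen.2 (Nat.pos_of_ne_zero h))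
    have : Unique {lam : YoungDiagram // lam.rowLen 0 = 0} :=
      { default := ⟨⊥, hbot⟩
        uniq := fun x => Subtype.ext (youngDiagram_ext fun i => by
          rw [rowLen_eq_zero_of_le x.2 (Nat.zero_le _),
            rowLen_eq_zero_of_le hbot (Nat.zero_le _)]) }
    refine ⟨(hasSum_unique _).summable, ?_⟩
    have h := hasSum_unique
      (fun lam : {lam : YoungDiagram // lam.rowLen 0 = 0} => q ^ lam.1.card)
    rw [card_eq_sum_rowLen (default : {lam : YoungDiagram // lam.rowLen 0 = 0}).2,
      Finset.sum_range_zero, pow_zero] at h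
    rw [Finset.prod_range_zero]
    exact h
  | succ k ih =>
    have hk : ‖q ^ (k + 1)‖ < 1 := by
      rw [norm_pow]
      exact pow_lt_one₀ (norm_nonneg _) hq (by omega)
    have hg := hasSum_geometric_of_norm_lt_one hk
    have hgn : Summable fun n : ℕ => ‖(q ^ (k + 1)) ^ n‖ := by
      simp only [norm_pow _ _]
      rw [norm_pow] at hk
      exact summable_geometric_of_lt_one (by positivity) hk
    let e := Equiv.ofBijective _ (addColumns_bijective k)
    have he : (fun lam : {lam : YoungDiagram // lam.rowLen (k + 1) = 0} => q ^ lam.1.card) ∘ e =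
        fun x => q ^ x.1.1.card * (q ^ (k + 1)) ^ x.2 := by
      funext x
      change q ^ (addColumns k x).1.card = _
      rw [card_eq_of_rowLen_add x.1.2 (rowLen_addColumns k x), pow_add, pow_mul]
    constructor
    · rw [← e.summable_iff]
      have := ih.1.mul_norm hgn
      refine this.congr fun x => ?_
      exact congrArg norm (congrFun he x).symm
    · rw [← e.hasSum_iff, he, Finset.prod_range_succ]
      exact HasSum.mul (f := fun lam : {lam : YoungDiagram // lam.rowLen k = 0} => q ^ lam.1.card)
        (g := fun m : ℕ => (q ^ (k + 1)) ^ m) ih.2 hg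
        (summable_mul_of_summable_norm
          (f := fun lam : {lam : YoungDiagram // lam.rowLen k = 0} => q ^ lam.1.card)
          (g := fun m : ℕ => (q ^ (k + 1)) ^ m) ih.1 hgn)

theorem summable_norm_neg_pow_succ {R : Type*} [NormedField R] [CompleteSpace R] {q : R}
    (hq : ‖q‖ < 1) : Summable fun j : ℕ => ‖-q ^ (j + 1)‖ := by
  simp only [norm_neg, norm_pow]
  exact (summable_nat_add_iff 1).mpr (summable_geometric_of_lt_one (norm_nonneg _) hq)

theorem tendsto_prod_one_sub_pow {R : Type*} [NormedField R] [CompleteSpace R] {q : R}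
    (hq : ‖q‖ < 1) : Filter.Tendsto (fun k => ∏ j ∈ Finset.range k, (1 - q ^ (j + 1)))
      Filter.atTop (𝓝 (∏' j : ℕ, (1 - q ^ (j + 1)))) := by
  have := (multipliable_one_add_of_summable (f := fun j : ℕ => -q ^ (j + 1))
    (summable_norm_neg_pow_succ hq)).hasProd.tendsto_prod_nat
  simpa only [← sub_eq_add_neg] using this

theorem one_sub_pow_ne_zero {R : Type*} [NormedField R] {q : R} (hq : ‖q‖ < 1) (j : ℕ) :
    1 - q ^ (j + 1) ≠ 0 := by
  intro h
  have : ‖q ^ (j + 1)‖ < 1 := by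
    rw [norm_pow]
    exact pow_lt_one₀ (norm_nonneg _) hq (by omega)
  rw [← sub_eq_zero.1 h, norm_one] at this
  exact lt_irrefl _ this

/-- Any finite set of diagrams has a common bound on the number of rows, so its partial sum is at
most a finite Euler product, and these products converge. -/
theorem summable_pow_card {r : ℝ} (h0 : 0 ≤ r) (h1 : r < 1) :
    Summable fun lam : YoungDiagram => r ^ lam.card := by
  have hr : ‖r‖ < 1 := by rwa [Real.norm_of_nonneg h0]
  have hne : ∏' j : ℕ, (1 - r ^ (j + 1)) ≠ 0 := by
    have := tprod_one_add_ne_zero_of_summable (f := fun j : ℕ => -r ^ (j + 1))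
      (fun j => by rw [← sub_eq_add_neg]; exact one_sub_pow_ne_zero hr j)
      (summable_norm_neg_pow_succ hr)
    simpa only [← sub_eq_add_neg] using this
  obtain ⟨c, hc⟩ := ((tendsto_prod_one_sub_pow hr).inv₀ hne).bddAbove_range
  refine summable_of_sum_le (c := c) (fun lam => by positivity) fun u => ?_
  classical
  have hex : ∃ k, ∀ lam ∈ u, lam.rowLen k = 0 := by
    induction u using Finset.induction_on with
    | empty => exact ⟨0, by simp⟩
    | insert a u _ ih =>
      obtain ⟨k, hk⟩ := ih
      obtain ⟨K, hK⟩ := exists_rowLen_eq_zero a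
      refine ⟨max k K, fun lam hlam => ?_⟩
      rcases Finset.mem_insert.1 hlam with rfl | h
      · exact rowLen_eq_zero_of_le hK (le_max_right _ _)
      · exact rowLen_eq_zero_of_le (hk lam h) (le_max_left _ _)
  obtain ⟨k, hk⟩ := hex
  have h2 := (hasSum_pow_card_rows hr k).2
  have h3 : ∑ lam ∈ u, r ^ lam.card = ∑ lam ∈ u.subtype (fun lam => lam.rowLen k = 0),
      r ^ lam.1.card := by
    rw [Finset.sum_subtype_of_mem (fun lam : YoungDiagram => r ^ lam.card) hk]
  rw [h3]
  refine (sum_le_hasSum _ (fun i _ => by positivity) h2).trans ?_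
  rw [Finset.prod_inv_distrib]
  exact hc ⟨k, rfl⟩

theorem summable_norm_pow_card {q : ℂ} (hq : ‖q‖ < 1) :
    Summable fun lam : YoungDiagram => ‖q ^ lam.card‖ := by
  simp only [norm_pow]
  exact summable_pow_card (norm_nonneg _) hq

theorem qPoch_mul_tsum {q : ℂ} (hq : ‖q‖ < 1) :
    qPoch q * ∑' lam : YoungDiagram, q ^ lam.card = 1 := by
  have h1 : Filter.Tendsto (fun k : ℕ => ∑' lam : YoungDiagram,
      ({lam : YoungDiagram | lam.rowLen k = 0}).indicator (fun lam => q ^ lam.card) lam)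
      Filter.atTop (𝓝 (∑' lam : YoungDiagram, q ^ lam.card)) := by
    refine tendsto_tsum_of_dominated_convergence (summable_norm_pow_card hq) (fun lam => ?_)
      (Filter.Eventually.of_forall fun k lam => norm_indicator_le_norm_self _ _)
    obtain ⟨K, hK⟩ := exists_rowLen_eq_zero lam
    refine tendsto_const_nhds.congr' ?_
    filter_upwards [Filter.eventually_ge_atTop K] with k hk
    rw [Set.indicator_of_mem (show lam ∈ {lam : YoungDiagram | lam.rowLen k = 0} from
      rowLen_eq_zero_of_le hK hk)]
  have h2 := (tendsto_prod_one_sub_pow hq).mul h1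
  refine tendsto_nhds_unique h2 (tendsto_const_nhds.congr fun k => ?_)
  rw [← tsum_subtype]
  have h3 := (hasSum_pow_card_rows hq k).2.tsum_eq
  refine Eq.trans ?_ (congrArg (fun z => (∏ j ∈ Finset.range k, (1 - q ^ (j + 1))) * z) h3.symm)
  rw [← Finset.prod_mul_distrib, Finset.prod_eq_one]
  intro j _
  exact mul_inv_cancel₀ (one_sub_pow_ne_zero hq j)

/-- Splitting off the first row embeds diagrams into pairs (length, remaining diagram). Dropping the
constraint between the two leaves a geometric series in `T * r` times the partition series. -/
theorem summable_pow_rowLen_mul_pow_card {r T : ℝ} (h0 : 0 ≤ r) (h1 : r < 1) (hT : 0 ≤ T)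
    (hrT : T * r < 1) :
    Summable fun lam : YoungDiagram => T ^ lam.rowLen 0 * r ^ lam.card := by
  have hex (lam : YoungDiagram) : ∃ mu : YoungDiagram, ∀ i, mu.rowLen i = lam.rowLen (i + 1) := by
    obtain ⟨K, hK⟩ := exists_rowLen_eq_zero lam
    exact exists_youngDiagram_rowLen (fun i => lam.rowLen (i + 1))
      (fun i j hij => lam.rowLen_anti _ _ (by omega))
      ⟨K, rowLen_eq_zero_of_le hK (by omega)⟩
  choose tail htail using hex
  have hinj : Function.Injective fun lam : YoungDiagram => (lam.rowLen 0, tail lam) := by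
    intro lam mu h
    rw [Prod.mk.injEq] at h
    refine youngDiagram_ext fun i => ?_
    cases i with
    | zero => exact h.1
    | succ i => rw [← htail, ← htail, h.2]
  have h2 := (summable_geometric_of_lt_one (mul_nonneg hT h0) hrT).mul_of_nonneg
    (summable_pow_card h0 h1) (fun n => by positivity) (fun lam => by positivity)
  refine (h2.comp_injective hinj).congr fun lam => ?_
  obtain ⟨K, hK⟩ := exists_rowLen_eq_zero lam
  have hK1 : lam.rowLen (K + 1) = 0 := rowLen_eq_zero_of_le hK (by omega)
  have hK2 : (tail lam).rowLen K = 0 := by rw [htail, hK1]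
  have h3 : lam.card = lam.rowLen 0 + (tail lam).card := by
    rw [card_eq_sum_rowLen hK1, card_eq_sum_rowLen hK2, Finset.sum_range_succ', add_comm]
    simp only [htail]
  change (T * r) ^ lam.rowLen 0 * r ^ (tail lam).card = _
  rw [h3, mul_pow, pow_add, mul_assoc]

/-! ### The series for Θ and its derivatives -/

/-- This is the odd-index part of the majorant used for the Jacobi theta function, with `r` and `B`
written as exponentials. -/
theorem summable_zpow_sq_mul_pow_abs {r B : ℝ} (hr0 : 0 < r) (hr1 : r < 1) (hB : 0 < B) (k : ℕ) :
    Summable fun m : ℤ => r ^ ((2 * m + 1) ^ 2) * |(2 * m + 1 : ℝ)| ^ k * B ^ |2 * m + 1| := by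
  have hT : 0 < -Real.log r / Real.pi := div_pos (neg_pos.2 (Real.log_neg hr0 hr1)) Real.pi_pos
  have h := summable_pow_mul_jacobiTheta₂_term_bound (Real.log B / (2 * Real.pi)) hT k
  have hinj : Function.Injective fun m : ℤ => 2 * m + 1 := by
    intro a b hab
    dsimp only at hab
    omega
  refine (h.comp_injective hinj).congr fun m => ?_
  have h1 : r ^ ((2 * m + 1) ^ 2) = Real.exp (((2 * m + 1) ^ 2 : ℤ) * Real.log r) := by
    rw [mul_comm _ (Real.log _), ← Real.rpow_def_of_pos hr0, Real.rpow_intCast]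
  have h2 : B ^ |2 * m + 1| = Real.exp ((|2 * m + 1| : ℤ) * Real.log B) := by
    rw [mul_comm _ (Real.log _), ← Real.rpow_def_of_pos hB, Real.rpow_intCast]
  rw [h1, h2, mul_comm (Real.exp _), mul_assoc, ← Real.exp_add]
  simp only [Function.comp]
  push_cast
  congr 2
  have := Real.pi_ne_zero
  field_simp
  ring

theorem zpow_le_zpow_abs {r B : ℝ} (hr : 0 < r) (h1 : r ≤ B) (h2 : r⁻¹ ≤ B) (n : ℤ) :
    r ^ n ≤ B ^ |n| := by
  rcases le_total 0 n with h | h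
  · rw [abs_of_nonneg h]
    exact zpow_le_zpow_left₀ h hr.le h1
  · rw [abs_of_nonpos h, ← neg_neg n, zpow_neg, ← inv_zpow, neg_neg]
    exact zpow_le_zpow_left₀ (by omega) (by positivity) h2

/-- The terms of the series for `Θ^{(k)}`. -/
def thetaTerm (κ : ℂ) (k : ℕ) (m : ℤ) (s : ℂ) : ℂ :=
  (-1 : ℂ) ^ m * κ ^ ((2 * m + 1) ^ 2) * ((2 * m + 1) / 2) ^ k * s ^ (2 * m + 1)

theorem norm_thetaTerm_le {κ : ℂ} {s : ℂ} (hs : s ≠ 0) {B : ℝ} (h1 : ‖s‖ ≤ B) (h2 : ‖s‖⁻¹ ≤ B)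
    (k : ℕ) (m : ℤ) :
    ‖thetaTerm κ k m s‖ ≤ ‖κ‖ ^ ((2 * m + 1) ^ 2) * |(2 * m + 1 : ℝ)| ^ k * B ^ |2 * m + 1| := by
  have h3 : ‖(2 * (m : ℂ) + 1) / 2‖ ≤ |(2 * m + 1 : ℝ)| := by
    rw [norm_div]
    have : ‖2 * (m : ℂ) + 1‖ = |(2 * m + 1 : ℝ)| := by
      rw [← Real.norm_eq_abs, ← Complex.norm_real]
      push_cast
      rfl
    rw [this]
    norm_num
  have h4 := zpow_le_zpow_abs (norm_pos_iff.2 hs) h1 h2 (2 * m + 1)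
  rw [thetaTerm, norm_mul, norm_mul, norm_mul, norm_zpow, norm_zpow, norm_zpow, norm_pow, norm_neg,
    norm_one, one_zpow, one_mul]
  gcongr

section

variable {κ : ℂ}

theorem summable_norm_thetaTerm (h0 : κ ≠ 0) (h1 : ‖κ‖ < 1) (k : ℕ) {s : ℂ} (hs : s ≠ 0) :
    Summable fun m : ℤ => ‖thetaTerm κ k m s‖ :=
  (summable_zpow_sq_mul_pow_abs (norm_pos_iff.2 h0) h1
    (lt_of_lt_of_le (norm_pos_iff.2 hs) (le_max_left _ ‖s‖⁻¹)) k).of_nonneg_of_le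
    (fun _ => norm_nonneg _)
    (fun m => norm_thetaTerm_le hs (le_max_left _ _) (le_max_right _ _) k m)

theorem hasDerivAt_tsum_thetaTerm (h0 : κ ≠ 0) (h1 : ‖κ‖ < 1) (k : ℕ) {s : ℂ} (hs : s ≠ 0) :
    HasDerivAt (fun z => ∑' m : ℤ, thetaTerm κ k m z)
      (2 / s * ∑' m : ℤ, thetaTerm κ (k + 1) m s) s := by
  have hpos := norm_pos_iff.2 hs
  -- On the ball of radius `‖s‖ / 2` around `s`, this constant bounds both `‖z‖` and `‖z‖⁻¹`, so one
  -- majorant serves positive and negative exponents.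
  let B := max (2 * ‖s‖) (2 * ‖s‖⁻¹)
  have hB : 0 < B := lt_of_lt_of_le (by positivity) (le_max_left _ _)
  have hball {z : ℂ} (hz : z ∈ Metric.ball s (‖s‖ / 2)) :
      z ≠ 0 ∧ ‖z‖ ≤ B ∧ ‖z‖⁻¹ ≤ B ∧ ‖z‖⁻¹ ≤ 2 * ‖s‖⁻¹ := by
    rw [Metric.mem_ball, dist_eq_norm] at hz
    have h2 := norm_sub_norm_le z s
    have h3 := norm_sub_norm_le s z
    rw [norm_sub_rev] at h3
    have h4 : 0 < ‖z‖ := by linarith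
    have h5 : ‖z‖⁻¹ ≤ 2 * ‖s‖⁻¹ := by
      rw [inv_le_comm₀ h4 (by positivity), mul_inv, inv_inv]
      linarith
    exact ⟨norm_pos_iff.1 h4, le_trans (by linarith) (le_max_left _ _),
      h5.trans (le_max_right _ _), h5⟩
  have hd (m : ℤ) (z : ℂ) (hz : z ≠ 0) :
      HasDerivAt (thetaTerm κ k m) (2 / z * thetaTerm κ (k + 1) m z) z := by
    have := (hasDerivAt_zpow (2 * m + 1) z (Or.inl hz)).const_mul
      ((-1 : ℂ) ^ m * κ ^ ((2 * m + 1) ^ 2) * ((2 * m + 1) / 2) ^ k)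
    refine this.congr_deriv ?_
    rw [thetaTerm, pow_succ _ k, zpow_sub_one₀ hz]
    push_cast
    field_simp
  have := hasDerivAt_tsum_of_isPreconnected
    (u := fun m : ℤ => 2 * (2 * ‖s‖⁻¹) *
      (‖κ‖ ^ ((2 * m + 1) ^ 2) * |(2 * m + 1 : ℝ)| ^ (k + 1) * B ^ |2 * m + 1|))
    ((summable_zpow_sq_mul_pow_abs (norm_pos_iff.2 h0) h1 hB (k + 1)).mul_left _)
    Metric.isOpen_ball (convex_ball s (‖s‖ / 2)).isPreconnected
    (g := fun m => thetaTerm κ k m) (g' := fun m z => 2 / z * thetaTerm κ (k + 1) m z)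
    (fun m z hz => hd m z (hball hz).1) (fun m z hz => ?_)
    (Metric.mem_ball_self (by positivity)) (summable_norm_thetaTerm h0 h1 k hs).of_norm
    (Metric.mem_ball_self (by positivity))
  · rwa [tsum_mul_left] at this
  · obtain ⟨hz0, hz1, hz2, hz3⟩ := hball hz
    rw [norm_mul, norm_div, div_eq_mul_inv]
    have h2 : ‖(2 : ℂ)‖ = 2 := by norm_num
    rw [h2]
    have := norm_thetaTerm_le (κ := κ) hz0 hz1 hz2 (k + 1) m
    gcongr

theorem thetaDeriv_eq_tsum (h0 : κ ≠ 0) (h1 : ‖κ‖ < 1) (k : ℕ) {s : ℂ} (hs : s ≠ 0) :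
    thetaDeriv κ k s = ∑' m : ℤ, thetaTerm κ k m s := by
  induction k generalizing s with
  | zero =>
    simp only [thetaDeriv, Function.iterate_zero, id, theta, thetaTerm, pow_zero, mul_one]
  | succ k ih =>
    have h2 : thetaDeriv κ k =ᶠ[𝓝 s] fun z => ∑' m : ℤ, thetaTerm κ k m z := by
      filter_upwards [isOpen_ne.mem_nhds hs] with z hz using ih hz
    rw [thetaDeriv, Function.iterate_succ_apply']
    change s / 2 * deriv (thetaDeriv κ k) s = _
    rw [h2.deriv_eq, (hasDerivAt_tsum_thetaTerm h0 h1 k hs).deriv]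
    field_simp

theorem analyticAt_thetaDeriv (h0 : κ ≠ 0) (h1 : ‖κ‖ < 1) (k : ℕ) {s : ℂ} (hs : s ≠ 0) :
    AnalyticAt ℂ (thetaDeriv κ k) s := by
  have hd : DifferentiableOn ℂ (thetaDeriv κ k) {z : ℂ | z ≠ 0} := by
    have : DifferentiableOn ℂ (fun z => ∑' m : ℤ, thetaTerm κ k m z) {z : ℂ | z ≠ 0} :=
      fun z hz => (hasDerivAt_tsum_thetaTerm h0 h1 k hz).differentiableAt.differentiableWithinAt
    exact this.congr fun z hz => thetaDeriv_eq_tsum h0 h1 k hz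
  exact hd.analyticAt (isOpen_ne.mem_nhds hs)

end

/-! ### The recursion for correlation functions from pairing states -/

section

variable {κ q : ℂ}

theorem tsum_eq_tsum_occupy {h : ℤ × YoungDiagram → ℂ} (hh : Summable h) (a : ℤ) :
    ∑' x, h x = ∑' x : {x // a ∉ maya x}, (h (occupy a x).1 + h x.1) := by
  have h1 := hh.tsum_subtype_add_tsum_subtype_compl {x | a ∈ maya x}
  have h2 : ∑' x : {x // a ∈ maya x}, h x.1 = ∑' x : {x // a ∉ maya x}, h (occupy a x).1 :=
    ((occupyEquiv a).tsum_eq fun x : {x // a ∈ maya x} => h x.1).symm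
  have h3 : Summable fun x : {x // a ∉ maya x} => h (occupy a x).1 :=
    (hh.comp_injective Subtype.val_injective).comp_injective (occupyEquiv a).injective
  have h4 : Summable fun x : {x // a ∉ maya x} => h x.1 :=
    hh.comp_injective Subtype.val_injective
  rw [h3.tsum_add h4, ← h1, ← h2]
  rfl

/-- The weight of a state: its sign and `q^{energy}` up to the constant `κ`. -/
def stateWeight (κ : ℂ) (x : ℤ × YoungDiagram) : ℂ :=
  (-1) ^ x.1 * κ ^ ((2 * x.1 + 1) ^ 2) * κ ^ (8 * (x.2.card : ℤ))

/-- The increase of `(2c + 1)²` by `8c + 8` cancels the dependence of the change in size on the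
charge; only `8a` remains. -/
theorem stateWeight_occupy (h0 : κ ≠ 0) (a : ℤ) (x : {x : ℤ × YoungDiagram // a ∉ maya x}) :
    stateWeight κ (occupy a x).1 = -κ ^ (8 * a) * stateWeight κ x.1 := by
  simp only [stateWeight]
  rw [mul_assoc, ← zpow_add₀ h0, mul_assoc ((-1 : ℂ) ^ x.1.1), ← zpow_add₀ h0, occupy_charge,
    occupy_card, zpow_add_one₀ (by norm_num)]
  rw [show (2 * (x.1.1 + 1) + 1) ^ 2 + 8 * ((x.1.2.card : ℤ) - x.1.1 + a - 1) =
    8 * a + ((2 * x.1.1 + 1) ^ 2 + 8 * x.1.2.card) by ring, zpow_add₀ h0 (8 * a)]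
  ring

/-- The sum of `t^{λ_i - i + 1/2}` over the rows, where `t = s²`. -/
def rowSum (s : ℂ) (lam : YoungDiagram) : ℂ := ∑' i : ℕ, rowTerm s lam i

section rows

variable {s : ℂ}

theorem norm_rowTerm_le (hs : 1 < ‖s‖) (lam : YoungDiagram) (i : ℕ) :
    ‖rowTerm s lam i‖ ≤ (‖s‖ ^ 2) ^ lam.rowLen 0 * ((‖s‖ ^ 2)⁻¹) ^ i := by
  have h0 : ‖s‖ ≠ 0 := by positivity
  have h1 : (‖s‖ ^ 2) ^ lam.rowLen 0 * ((‖s‖ ^ 2)⁻¹) ^ i =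
      ‖s‖ ^ (2 * (lam.rowLen 0 : ℤ) - 2 * i) := by
    rw [zpow_sub₀ h0, zpow_mul, zpow_mul, inv_pow, div_eq_mul_inv]
    norm_cast
  rw [h1, rowTerm, norm_zpow]
  refine zpow_le_zpow_right₀ hs.le ?_
  have := lam.rowLen_anti 0 i (Nat.zero_le _)
  omega

theorem summable_rowTerm_bound (hs : 1 < ‖s‖) :
    Summable fun i : ℕ => ((‖s‖ ^ 2)⁻¹) ^ i :=
  summable_geometric_of_lt_one (by positivity) (inv_lt_one_of_one_lt₀ (by nlinarith))

theorem summable_rowTerm (hs : 1 < ‖s‖) (lam : YoungDiagram) : Summable (rowTerm s lam) :=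
  Summable.of_norm_bounded ((summable_rowTerm_bound hs).mul_left _) (norm_rowTerm_le hs lam)

theorem norm_rowSum_le (hs : 1 < ‖s‖) (lam : YoungDiagram) :
    ‖rowSum s lam‖ ≤ (‖s‖ ^ 2) ^ lam.rowLen 0 * ∑' i : ℕ, ((‖s‖ ^ 2)⁻¹) ^ i := by
  rw [← tsum_mul_left]
  exact tsum_of_norm_bounded ((summable_rowTerm_bound hs).mul_left _).hasSum
    (norm_rowTerm_le hs lam)

/-- The factor `s ^ (2c + 1)` turns the half-integral powers of `t = s²` into powers indexed by
occupied sites, so that adding a site adds one term. -/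
theorem hasSum_maya (hs : 1 < ‖s‖) (x : ℤ × YoungDiagram) :
    HasSum (fun b : maya x => (s ^ 2) ^ (b : ℤ)) (s ^ (2 * x.1 + 1) * rowSum s x.2) := by
  have h0 : s ≠ 0 := norm_pos_iff.1 (by linarith)
  let e : ℕ ≃ maya x := Equiv.ofInjective _ (site_strictAnti x).injective
  rw [← e.hasSum_iff]
  have h1 := (summable_rowTerm hs x.2).hasSum.mul_left (s ^ (2 * x.1 + 1))
  refine h1.congr_fun fun i => ?_
  change (s ^ 2) ^ (site x i) = _
  rw [rowTerm, ← zpow_add₀ h0, ← zpow_natCast, ← zpow_mul]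
  congr 1
  simp only [site]
  push_cast
  ring

theorem rowSum_occupy (hs : 1 < ‖s‖) (a : ℤ) (x : {x : ℤ × YoungDiagram // a ∉ maya x}) :
    s ^ (2 * (occupy a x).1.1 + 1) * rowSum s (occupy a x).1.2 =
      (s ^ 2) ^ a + s ^ (2 * x.1.1 + 1) * rowSum s x.1.2 := by
  have h1 := hasSum_maya hs (occupy a x).1
  have h2 : HasSum (fun b : ({a} : Set ℤ) => (s ^ 2) ^ (b : ℤ)) ((s ^ 2) ^ a) := by
    simpa using hasSum_unique (fun b : ({a} : Set ℤ) => (s ^ 2) ^ (b : ℤ))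
  have h3 := HasSum.add_disjoint (f := fun b : ℤ => (s ^ 2) ^ b)
    (Set.disjoint_singleton_left.2 x.2) h2 (hasSum_maya hs x.1)
  rw [maya_occupy, Set.insert_eq] at h1
  exact h1.unique h3

end rows

section correlations

variable {ι : Type*} {s : ι → ℂ} {M N : Finset ι}

/-- The correlation function of the variables with index in `M`. -/
def corr (q : ℂ) (s : ι → ℂ) (M : Finset ι) : ℂ :=
  qPoch q * ∑' lam : YoungDiagram, (∏ k ∈ M, rowSum (s k) lam) * q ^ lam.card

theorem summable_norm_prod_rowSum (hq1 : ‖q‖ < 1) (hs : ∀ k ∈ M, 1 < ‖s k‖)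
    (hM : (∏ k ∈ M, ‖s k‖ ^ 2) * ‖q‖ < 1) :
    Summable fun lam : YoungDiagram => ‖(∏ k ∈ M, rowSum (s k) lam) * q ^ lam.card‖ := by
  refine ((summable_pow_rowLen_mul_pow_card (norm_nonneg q) hq1
    (Finset.prod_nonneg fun k _ => by positivity) hM).mul_left
    (∏ k ∈ M, ∑' i : ℕ, ((‖s k‖ ^ 2)⁻¹) ^ i)).of_nonneg_of_le (fun _ => norm_nonneg _)
    fun lam => ?_
  rw [norm_mul, norm_prod, norm_pow, ← mul_assoc, ← Finset.prod_pow, ← Finset.prod_mul_distrib]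
  refine mul_le_mul_of_nonneg_right ?_ (by positivity)
  refine Finset.prod_le_prod (fun _ _ => norm_nonneg _) fun k hk => ?_
  rw [mul_comm]
  exact norm_rowSum_le (hs k hk) lam

theorem prod_norm_sq_mul_lt (hs : ∀ k ∈ N, 1 < ‖s k‖)
    (hN : (∏ k ∈ N, ‖s k‖ ^ 2) * ‖q‖ < 1) (h : M ⊆ N) : (∏ k ∈ M, ‖s k‖ ^ 2) * ‖q‖ < 1 := by
  refine lt_of_le_of_lt (mul_le_mul_of_nonneg_right ?_ (norm_nonneg q)) hN
  refine Finset.prod_le_prod_of_subset_of_one_le h (fun k _ => by positivity) fun k hk _ => ?_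
  have := hs k hk
  nlinarith

theorem corr_empty (hq1 : ‖q‖ < 1) : corr q s ∅ = 1 := by
  simp only [corr, Finset.prod_empty, one_mul]
  exact qPoch_mul_tsum hq1

/-- The sum over all charges and partitions of `g` below is evaluated twice: pairing states by the
site 0 gives zero, and expanding the product gives the left-hand side. For `N = ∅` it says Θ(1) = 0.
-/
theorem sum_thetaDeriv_mul_corr [DecidableEq ι] (h0 : κ ≠ 0) (h1 : ‖κ‖ < 1) (hκ : κ ^ 8 = q)
    (hs : ∀ k ∈ N, 1 < ‖s k‖) (hN : (∏ k ∈ N, ‖s k‖ ^ 2) * ‖q‖ < 1) :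
    ∑ M ∈ N.powerset, (-1) ^ M.card * thetaDeriv κ (N.card - M.card) (∏ k ∈ M, s k) *
      corr q s M = 0 := by
  have hq1 : ‖q‖ < 1 := by
    rw [← hκ, norm_pow]
    exact pow_lt_one₀ (norm_nonneg _) h1 (by norm_num)
  let g : ℤ × YoungDiagram → ℂ := fun x => stateWeight κ x *
    ∏ k ∈ N, ((2 * (x.1 : ℂ) + 1) / 2 - s k ^ (2 * x.1 + 1) * rowSum (s k) x.2)
  let G : Finset ι → ℤ × YoungDiagram → ℂ := fun M x => (-1) ^ M.card *
    (thetaTerm κ (N.card - M.card) x.1 (∏ k ∈ M, s k) *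
      ((∏ k ∈ M, rowSum (s k) x.2) * q ^ x.2.card))
  -- `M` collects the factors from which the row sum is chosen; the other factors supply the power
  -- of `c + 1/2` that differentiates Θ.
  have hgG (x : ℤ × YoungDiagram) : g x = ∑ M ∈ N.powerset, G M x := by
    simp only [g, G, sub_eq_neg_add]
    rw [Finset.prod_add, Finset.mul_sum]
    refine Finset.sum_congr rfl fun M hM => ?_
    rw [Finset.prod_neg, Finset.prod_mul_distrib, Finset.prod_zpow, Finset.prod_const,
      Finset.card_sdiff_of_subset (Finset.mem_powerset.1 hM), stateWeight, thetaTerm, ← hκ,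
      ← pow_mul]
    norm_cast
    ring
  have hne (M : Finset ι) (hM : M ∈ N.powerset) : ∏ k ∈ M, s k ≠ 0 :=
    Finset.prod_ne_zero_iff.2 fun k hk =>
      norm_pos_iff.1 (by linarith [hs k (Finset.mem_powerset.1 hM hk)])
  have hA (M : Finset ι) (hM : M ∈ N.powerset) :=
    summable_norm_thetaTerm h0 h1 (N.card - M.card) (hne M hM)
  have hB (M : Finset ι) (hM : M ∈ N.powerset) :=
    summable_norm_prod_rowSum hq1 (fun k hk => hs k (Finset.mem_powerset.1 hM hk))
      (prod_norm_sq_mul_lt hs hN (Finset.mem_powerset.1 hM))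
  have hG (M : Finset ι) (hM : M ∈ N.powerset) : Summable (G M) :=
    (summable_mul_of_summable_norm
      (f := fun m => thetaTerm κ (N.card - M.card) m (∏ k ∈ M, s k))
      (g := fun lam : YoungDiagram => (∏ k ∈ M, rowSum (s k) lam) * q ^ lam.card)
      (hA M hM) (hB M hM)).mul_left _
  have hg : Summable g := by
    rw [show g = fun x => ∑ M ∈ N.powerset, G M x from funext hgG]
    exact summable_sum hG
  have hg0 : ∑' x, g x = 0 := by
    rw [tsum_eq_tsum_occupy hg 0]
    refine (tsum_congr fun x => ?_).trans tsum_zero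
    simp only [g]
    -- Filling site 0 negates the weight and adds 1 to both terms of every difference, so paired
    -- states cancel.
    rw [stateWeight_occupy h0, Finset.prod_congr rfl
      (g := fun k => (2 * (x.1.1 : ℂ) + 1) / 2 - s k ^ (2 * x.1.1 + 1) * rowSum (s k) x.1.2)]
    · rw [mul_zero, zpow_zero]
      ring
    · intro k hk
      rw [rowSum_occupy (hs k hk), occupy_charge, zpow_zero]
      push_cast
      ring
  have hsum : ∑' x, g x = ∑ M ∈ N.powerset, ∑' x, G M x := by
    rw [← Summable.tsum_finsetSum hG]
    exact tsum_congr hgG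
  have hGM (M : Finset ι) (hM : M ∈ N.powerset) : (-1) ^ M.card *
      thetaDeriv κ (N.card - M.card) (∏ k ∈ M, s k) * corr q s M = qPoch q * ∑' x, G M x := by
    simp only [G]
    rw [tsum_mul_left, ← tsum_mul_tsum_of_summable_norm
      (f := fun m => thetaTerm κ (N.card - M.card) m (∏ k ∈ M, s k))
      (g := fun lam : YoungDiagram => (∏ k ∈ M, rowSum (s k) lam) * q ^ lam.card)
      (hA M hM) (hB M hM), ← thetaDeriv_eq_tsum h0 h1 _ (hne M hM), corr]
    ring
  rw [Finset.sum_congr rfl hGM, ← Finset.mul_sum, ← hsum, hg0, mul_zero]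

end correlations

end

/-! ### Jacobi's product and the nonvanishing of Θ -/

section

variable {κ q s : ℂ}

/-- The states whose occupied sites agree with those of the vacuum outside of `A`. -/
def windowStates (A : Finset ℤ) : Set (ℤ × YoungDiagram) :=
  {x | ∀ b ∉ A, b ∈ maya x ↔ b ≤ 0}

theorem maya_vacuum : maya (0, ⊥) = {b | b ≤ 0} := by
  have h (i : ℕ) : site (0, ⊥) i = -i := by
    have : (⊥ : YoungDiagram).rowLen i = 0 := by
      by_contra h
      exact YoungDiagram.notMem_bot (i, 0)
        (YoungDiagram.mem_iff_lt_rowLen.2 (Nat.pos_of_ne_zero h))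
    simp [site, this]
  ext b
  constructor
  · rintro ⟨i, rfl⟩
    rw [h]
    simp
  · intro hb
    have hb : b ≤ 0 := hb
    exact ⟨b.natAbs, by rw [h]; omega⟩

theorem windowStates_empty : windowStates ∅ = {(0, ⊥)} := by
  ext x
  simp only [windowStates, Finset.notMem_empty, not_false_eq_true, true_imp_iff]
  refine ⟨fun h => maya_injective ?_, ?_⟩
  · rw [maya_vacuum]
    ext b
    exact h b
  · rintro rfl b
    rw [maya_vacuum]
    rfl

theorem eventually_mem_windowStates (x : ℤ × YoungDiagram) :
    ∀ᶠ A : Finset ℤ in Filter.atTop, x ∈ windowStates A := by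
  obtain ⟨K, hK⟩ := exists_rowLen_eq_zero x.2
  -- All sites up to `c - K` are occupied and none above `c + rowLen 0` is, so the state agrees with
  -- the vacuum outside this interval.
  filter_upwards [Filter.eventually_ge_atTop
    (Finset.Icc (-|x.1 - K|) (|x.1| + x.2.rowLen 0))] with A hA b hb
  have hb : ¬ (-|x.1 - K| ≤ b ∧ b ≤ |x.1| + x.2.rowLen 0) :=
    fun h => hb (hA (Finset.mem_Icc.2 h))
  constructor
  · rintro ⟨i, rfl⟩
    by_contra! h
    refine hb ⟨by linarith [abs_nonneg (x.1 - K)], ?_⟩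
    have h1 := x.2.rowLen_anti 0 i (Nat.zero_le _)
    have h2 := le_abs_self x.1
    simp only [site]
    omega
  · intro h
    have h1 : b < -|x.1 - K| := by
      by_contra! h'
      exact hb ⟨h', by linarith [abs_nonneg x.1, Int.natCast_nonneg (x.2.rowLen 0)]⟩
    have h2 := neg_abs_le (x.1 - K)
    refine ⟨(x.1 - b).toNat, ?_⟩
    simp only [site]
    rw [rowLen_eq_zero_of_le hK (by omega)]
    omega

/-- The factor that the site `a` contributes to the product formula for `Θ`. -/
def siteFactor (κ s : ℂ) (a : ℤ) : ℂ :=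
  if a ≤ 0 then -(κ ^ (8 * a) * s ^ 2)⁻¹ else -(κ ^ (8 * a) * s ^ 2)

/-- Each site of the window is filled or empty independently. Leaving the vacuum value at `a` costs
`siteFactor κ s a`, so each new site multiplies the sum by `1 + siteFactor κ s a`. -/
theorem tsum_indicator_windowStates (h0 : κ ≠ 0) (hs : s ≠ 0)
    (hsum : Summable fun x : ℤ × YoungDiagram => stateWeight κ x * s ^ (2 * x.1 + 1))
    (A : Finset ℤ) :
    ∑' x, (windowStates A).indicator (fun x => stateWeight κ x * s ^ (2 * x.1 + 1)) x =
      stateWeight κ (0, ⊥) * s * ∏ a ∈ A, (1 + siteFactor κ s a) := by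
  induction A using Finset.induction_on with
  | empty =>
    rw [windowStates_empty, tsum_eq_single (0, ⊥)]
    · simp
    · intro x hx
      exact Set.indicator_of_notMem (s := {(0, ⊥)}) hx _
  | insert a A ha ih =>
    set W := fun x : ℤ × YoungDiagram => stateWeight κ x * s ^ (2 * x.1 + 1) with hW
    have hocc (x : {x : ℤ × YoungDiagram // a ∉ maya x}) :
        W (occupy a x).1 = -(κ ^ (8 * a) * s ^ 2) * W x.1 := by
      simp only [hW]
      rw [stateWeight_occupy h0, occupy_charge,
        show 2 * (x.1.1 + 1) + 1 = (2 * x.1.1 + 1) + 2 by ring, zpow_add₀ hs]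
      norm_cast
      ring
    have hmem (x : {x : ℤ × YoungDiagram // a ∉ maya x}) :
        (occupy a x).1 ∈ windowStates (insert a A) ↔ x.1 ∈ windowStates (insert a A) := by
      refine forall₂_congr fun b hb => ?_
      have : b ≠ a := fun h => hb (h ▸ Finset.mem_insert_self _ _)
      rw [maya_occupy, Set.mem_insert_iff, or_iff_right this]
    have hiff (x : ℤ × YoungDiagram) :
        x ∈ windowStates A ↔ x ∈ windowStates (insert a A) ∧ (a ∈ maya x ↔ a ≤ 0) := by
      constructor
      · exact fun h => ⟨fun b hb => h b fun hb' => hb (Finset.mem_insert_of_mem hb'), h a ha⟩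
      · rintro ⟨h, h'⟩ b hb
        by_cases hba : b = a
        · rwa [hba]
        · exact h b fun hb' => (Finset.mem_insert.1 hb').elim hba hb
    have hc0 : κ ^ (8 * a) * s ^ 2 ≠ 0 := mul_ne_zero (zpow_ne_zero _ h0) (pow_ne_zero _ hs)
    rw [Finset.prod_insert ha, mul_left_comm, ← ih, tsum_eq_tsum_occupy (hsum.indicator _) a,
      tsum_eq_tsum_occupy (hsum.indicator _) a, ← tsum_mul_left]
    refine tsum_congr fun x => ?_
    have hx := x.2
    have hx' := (occupy a x).2
    by_cases hmx : x.1 ∈ windowStates (insert a A)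
    · rw [Set.indicator_of_mem hmx, Set.indicator_of_mem ((hmem x).2 hmx), hocc, siteFactor]
      by_cases hle : a ≤ 0
      · rw [if_pos hle, Set.indicator_of_mem ((hiff _).2 ⟨(hmem x).2 hmx, by tauto⟩),
          Set.indicator_of_notMem (fun h => by have := ((hiff _).1 h).2; tauto), hocc]
        field_simp
        ring
      · rw [if_neg hle, Set.indicator_of_notMem (fun h => by have := ((hiff _).1 h).2; tauto),
          Set.indicator_of_mem ((hiff _).2 ⟨hmx, by tauto⟩)]
        ring
    · rw [Set.indicator_of_notMem hmx, Set.indicator_of_notMem (fun h => hmx ((hmem x).1 h)),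
        Set.indicator_of_notMem (fun h => hmx ((hmem x).1 ((hiff _).1 h).1)),
        Set.indicator_of_notMem (fun h => hmx ((hiff _).1 h).1)]
      ring

/-- Letting the window exhaust ℤ gives the triple product: Θ times the partition series is a nonzero
constant times the product of all `1 + siteFactor κ s a`. The two bounds on `‖s‖` make every
`siteFactor` smaller than 1 in norm, so no factor vanishes. -/
theorem theta_ne_zero (h0 : κ ≠ 0) (h1 : ‖κ‖ < 1) (hs : 1 < ‖s‖) (hs' : ‖s‖ ^ 2 * ‖κ ^ 8‖ < 1) :
    theta κ s ≠ 0 := by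
  have hs0 : s ≠ 0 := norm_pos_iff.1 (by linarith)
  set r := ‖κ ^ 8‖ with hr
  have hr0 : 0 < r := norm_pos_iff.2 (pow_ne_zero _ h0)
  have hr1 : r < 1 := by
    rw [hr, norm_pow]
    exact pow_lt_one₀ (norm_nonneg _) h1 (by norm_num)
  have hs2 : 1 < ‖s‖ ^ 2 := by nlinarith
  have hfac (a : ℤ) : ‖siteFactor κ s a‖ ≤ ‖s‖ ^ 2 * r ^ a.natAbs ∧ ‖siteFactor κ s a‖ < 1 := by
    have hz : ‖κ ^ (8 * a) * s ^ 2‖ = r ^ a * ‖s‖ ^ 2 := by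
      rw [norm_mul, zpow_mul, norm_zpow, norm_pow s, hr]
      norm_cast
    rw [siteFactor]
    split_ifs with h
    · obtain ⟨m, rfl⟩ : ∃ m : ℕ, a = -m := ⟨a.natAbs, by omega⟩
      rw [norm_neg, norm_inv, hz, zpow_neg, mul_inv, inv_inv, zpow_natCast, Int.natAbs_neg,
        Int.natAbs_natCast]
      have h2 : (‖s‖ ^ 2)⁻¹ < 1 := inv_lt_one_of_one_lt₀ hs2
      have h3 : r ^ m ≤ 1 := pow_le_one₀ hr0.le hr1.le
      have h4 : 0 < r ^ m := by positivity
      have h5 : 0 < (‖s‖ ^ 2)⁻¹ := by positivity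
      constructor <;> nlinarith
    · obtain ⟨m, rfl⟩ : ∃ m : ℕ, a = m + 1 := ⟨a.natAbs - 1, by omega⟩
      rw [norm_neg, hz]
      norm_cast
      refine ⟨by rw [mul_comm], ?_⟩
      have h3 : r ^ m ≤ 1 := pow_le_one₀ hr0.le hr1.le
      rw [pow_succ]
      have h4 : 0 < r ^ m := by positivity
      nlinarith
  have hsumf : Summable fun a : ℤ => ‖siteFactor κ s a‖ := by
    refine Summable.of_nonneg_of_le (fun _ => norm_nonneg _) (fun a => (hfac a).1)
      (Summable.mul_left _ ?_)
    have := summable_geometric_of_lt_one hr0.le hr1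
    refine Summable.of_nat_of_neg ?_ ?_ <;> simpa using this
  have hprod : ∏' a : ℤ, (1 + siteFactor κ s a) ≠ 0 := by
    refine tprod_one_add_ne_zero_of_summable (fun a h => ?_) hsumf
    have h2 := (hfac a).2
    rw [← neg_eq_of_add_eq_zero_right h, norm_neg, norm_one] at h2
    exact lt_irrefl _ h2
  have hA : Summable fun m : ℤ => ‖(-1 : ℂ) ^ m * κ ^ ((2 * m + 1) ^ 2) * s ^ (2 * m + 1)‖ := by
    simpa only [thetaTerm, pow_zero, mul_one] using summable_norm_thetaTerm h0 h1 0 hs0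
  have hB := summable_norm_pow_card (q := κ ^ 8) hr1
  have hWeq : (fun x : ℤ × YoungDiagram => stateWeight κ x * s ^ (2 * x.1 + 1)) =
      fun x => ((-1 : ℂ) ^ x.1 * κ ^ ((2 * x.1 + 1) ^ 2) * s ^ (2 * x.1 + 1)) *
        (κ ^ 8) ^ x.2.card := by
    funext x
    rw [stateWeight, zpow_mul]
    norm_cast
    ring
  have hsum : Summable fun x : ℤ × YoungDiagram => stateWeight κ x * s ^ (2 * x.1 + 1) := by
    rw [hWeq]
    exact summable_mul_of_summable_norm
      (f := fun m : ℤ => (-1 : ℂ) ^ m * κ ^ ((2 * m + 1) ^ 2) * s ^ (2 * m + 1))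
      (g := fun lam : YoungDiagram => (κ ^ 8) ^ lam.card) hA hB
  have htsum : ∑' x : ℤ × YoungDiagram, stateWeight κ x * s ^ (2 * x.1 + 1) =
      theta κ s * ∑' lam : YoungDiagram, (κ ^ 8) ^ lam.card := by
    rw [hWeq, theta]
    exact (tsum_mul_tsum_of_summable_norm
      (f := fun m : ℤ => (-1 : ℂ) ^ m * κ ^ ((2 * m + 1) ^ 2) * s ^ (2 * m + 1))
      (g := fun lam : YoungDiagram => (κ ^ 8) ^ lam.card) hA hB).symm
  have hlim : Filter.Tendsto (fun A : Finset ℤ => ∑' x, (windowStates A).indicator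
      (fun x => stateWeight κ x * s ^ (2 * x.1 + 1)) x) Filter.atTop
      (𝓝 (∑' x : ℤ × YoungDiagram, stateWeight κ x * s ^ (2 * x.1 + 1))) := by
    refine tendsto_tsum_of_dominated_convergence hsum.norm (fun x => ?_)
      (Filter.Eventually.of_forall fun A x => norm_indicator_le_norm_self _ _)
    refine tendsto_const_nhds.congr' ?_
    filter_upwards [eventually_mem_windowStates x] with A hx
    rw [Set.indicator_of_mem hx]
  have hlim' := ((multipliable_one_add_of_summable hsumf).hasProd : Filter.Tendsto _ _ _).const_mul
    (stateWeight κ (0, ⊥) * s)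
  have heq := tendsto_nhds_unique (hlim.congr (tsum_indicator_windowStates h0 hs0 hsum)) hlim'
  rw [htsum] at heq
  intro hθ
  rw [hθ, zero_mul] at heq
  refine mul_ne_zero (mul_ne_zero ?_ hs0) hprod heq.symm
  simp only [stateWeight]
  exact mul_ne_zero (mul_ne_zero (by simp) (zpow_ne_zero _ h0)) (zpow_ne_zero _ h0)

end

/-! ### Triangular systems and Hessenberg determinants -/

section hessenberg

variable {K : Type*} [Field K]

/-- The solution of the triangular system `∑_{l ≤ m} (-1)^l a_{l,m-l} V_l = 0`, `m ≥ 1`,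
with `V_0 = 1`. -/
def triangularSol (a : ℕ → ℕ → K) : ℕ → K
  | 0 => 1
  | m + 1 => (∑ l : Fin (m + 1), (-1) ^ (m - l) * a l (m + 1 - l) * triangularSol a l) / a (m + 1) 0
decreasing_by exact l.2

theorem triangularSol_zero (a : ℕ → ℕ → K) : triangularSol a 0 = 1 := by
  rw [triangularSol]

theorem triangularSol_succ (a : ℕ → ℕ → K) (m : ℕ) : triangularSol a (m + 1) =
    (∑ l ∈ Finset.range (m + 1), (-1) ^ (m - l) * a l (m + 1 - l) * triangularSol a l) /
      a (m + 1) 0 := by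
  rw [triangularSol, Finset.sum_range]

theorem triangularSol_congr {a b : ℕ → ℕ → K} {m : ℕ} (h : ∀ l ≤ m, a l = b l) :
    triangularSol a m = triangularSol b m := by
  induction m using Nat.strong_induction_on with
  | _ m ih =>
    cases m with
    | zero => rw [triangularSol_zero, triangularSol_zero]
    | succ m =>
      rw [triangularSol_succ, triangularSol_succ, h (m + 1) le_rfl]
      congr 1
      refine Finset.sum_congr rfl fun l hl => ?_
      have hl := Finset.mem_range.1 hl
      rw [h l hl.le, ih l hl fun l' hl' => h l' (by omega)]

/-- The Hessenberg matrix with entries `a_{n-j,j-i+1}`, for indices counted from `1`. -/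
def hessenberg (a : ℕ → ℕ → K) (n : ℕ) : Matrix (Fin n) (Fin n) K :=
  Matrix.of fun i j => if (i : ℕ) ≤ (j : ℕ) + 1 then a (n - (j + 1)) (j + 1 - i) else 0

theorem hessenberg_apply (a : ℕ → ℕ → K) (n : ℕ) (i j : Fin n) :
    hessenberg a n i j =
      if (i : ℕ) ≤ (j : ℕ) + 1 then a (n - (j + 1)) (j + 1 - i) else 0 := rfl

/-- Up to sign, row `i ≥ 1` is the equation of index `n + 1 - i` of the triangular system. Row 0 is
the equation of index `n + 1` without its last term, which becomes the right-hand side. -/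
theorem hessenberg_mulVec {a : ℕ → ℕ → K} {n : ℕ} (ha : ∀ m ≤ n, a (m + 1) 0 ≠ 0) :
    (hessenberg a (n + 1)).mulVec (fun j => (-1) ^ (j : ℕ) * triangularSol a (n - j)) =
      Pi.single 0 (a (n + 1) 0 * triangularSol a (n + 1)) := by
  have hrec (m : ℕ) (hm : m ≤ n) :
      ∑ l ∈ Finset.range (m + 1), (-1) ^ (m - l) * a l (m + 1 - l) * triangularSol a l =
        a (m + 1) 0 * triangularSol a (m + 1) := by
    rw [triangularSol_succ, mul_div_cancel₀ _ (ha m hm)]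
  ext i
  simp only [Matrix.mulVec, dotProduct, hessenberg_apply]
  rw [Fin.sum_univ_eq_sum_range (fun j : ℕ =>
    (if (i : ℕ) ≤ j + 1 then a (n + 1 - (j + 1)) (j + 1 - i) else 0) *
      ((-1) ^ j * triangularSol a (n - j))) (n + 1), ← Finset.sum_range_reflect]
  have hi := i.2
  rcases Nat.eq_zero_or_pos (i : ℕ) with h0 | h0
  · have : i = 0 := Fin.ext h0
    rw [this, Pi.single_eq_same, ← hrec n le_rfl]
    refine Finset.sum_congr rfl fun l hl => ?_
    have hl := Finset.mem_range.1 hl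
    rw [if_pos (by simp), show n + 1 - (n + 1 - 1 - l + 1) = l by omega,
      show n - (n + 1 - 1 - l) = l by omega]
    simp only [Fin.val_zero]
    rw [show n + 1 - 1 - l + 1 - 0 = n + 1 - l by omega, show n + 1 - 1 - l = n - l by omega]
    ring
  · rw [Pi.single_eq_of_ne (fun h => by rw [h] at h0; simp at h0)]
    obtain ⟨m, hm⟩ : ∃ m, n = m + i := ⟨n - i, by omega⟩
    obtain ⟨p, hp⟩ : ∃ p, (i : ℕ) = p + 1 := ⟨i - 1, by omega⟩
    rw [← Finset.sum_subset (Finset.range_subset_range.2 (show m + 2 ≤ n + 1 by omega))]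
    · have h1 (l : ℕ) (hl : l ∈ Finset.range (m + 1)) :
          (if (i : ℕ) ≤ n + 1 - 1 - l + 1 then
            a (n + 1 - (n + 1 - 1 - l + 1)) (n + 1 - 1 - l + 1 - i) else 0) *
            ((-1) ^ (n + 1 - 1 - l) * triangularSol a (n - (n + 1 - 1 - l))) =
          (-1) ^ (p + 1) * ((-1) ^ (m - l) * a l (m + 1 - l) * triangularSol a l) := by
        have hl := Finset.mem_range.1 hl
        rw [if_pos (by omega), show n + 1 - (n + 1 - 1 - l + 1) = l by omega,
          show n - (n + 1 - 1 - l) = l by omega,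
          show n + 1 - 1 - l + 1 - (i : ℕ) = m + 1 - l by omega,
          show n + 1 - 1 - l = (p + 1) + (m - l) by omega, pow_add]
        ring
      rw [Finset.sum_range_succ, Finset.sum_congr rfl h1, ← Finset.mul_sum, hrec m (by omega),
        if_pos (by omega), show n + 1 - (n + 1 - 1 - (m + 1) + 1) = m + 1 by omega,
        show n - (n + 1 - 1 - (m + 1)) = m + 1 by omega,
        show n + 1 - 1 - (m + 1) + 1 - (i : ℕ) = 0 by omega,
        show n + 1 - 1 - (m + 1) = p by omega]
      ring
    · intro l hl hl'
      have h1 := Finset.mem_range.1 hl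
      have h2 : ¬ l < m + 2 := fun h => hl' (Finset.mem_range.2 h)
      rw [if_neg (by omega), zero_mul]

/-- Cramer's rule for the last coordinate of the vector in `hessenberg_mulVec`, which is `±1`
because the solution starts at 1. The minor left after deleting the first row and last column is
triangular with diagonal entries `a (m + 1) 0`. -/
theorem det_hessenberg {a : ℕ → ℕ → K} {n : ℕ} (ha : ∀ m < n, a (m + 1) 0 ≠ 0) :
    (hessenberg a n).det = triangularSol a n * ∏ m ∈ Finset.range n, a (m + 1) 0 := by
  cases n with
  | zero => simp [triangularSol_zero]
  | succ n =>
    set v : Fin (n + 1) → K := fun j => (-1) ^ (j : ℕ) * triangularSol a (n - j) with hv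
    -- In adjugate form Cramer's rule does not require the determinant to be invertible.
    have h1 : Matrix.cramer (hessenberg a (n + 1)) ((hessenberg a (n + 1)).mulVec v) =
        (hessenberg a (n + 1)).det • v := by
      rw [Matrix.cramer_eq_adjugate_mulVec, Matrix.mulVec_mulVec, Matrix.adjugate_mul,
        Matrix.smul_mulVec, Matrix.one_mulVec]
    have h2 := congrFun h1 (Fin.last n)
    rw [hv, hessenberg_mulVec (fun m hm => ha m (by omega)), Matrix.cramer_apply,
      Matrix.det_succ_column _ (Fin.last n), Finset.sum_eq_single 0] at h2
    · have h3 : (((hessenberg a (n + 1)).updateCol (Fin.last n)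
          (Pi.single 0 (a (n + 1) 0 * triangularSol a (n + 1)))).submatrix
          (Fin.succAbove 0) (Fin.last n).succAbove).det = ∏ m ∈ Finset.range n, a (m + 1) 0 := by
        rw [Matrix.det_of_isUpperTriangular]
        · rw [← Finset.prod_range_reflect, Finset.prod_range]
          refine Finset.prod_congr rfl fun i _ => ?_
          rw [Matrix.submatrix_apply, Matrix.updateCol_ne (by simp [Fin.succAbove_last,
            (Fin.castSucc_lt_last i).ne]), hessenberg_apply]
          have := i.2
          simp only [Fin.succAbove_zero, Fin.succAbove_last, Fin.val_succ, Fin.val_castSucc,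
            le_refl, if_true, Nat.sub_self]
          congr 1
          omega
        · intro i j hij
          rw [Matrix.submatrix_apply, Matrix.updateCol_ne (by simp [Fin.succAbove_last,
            (Fin.castSucc_lt_last j).ne]), hessenberg_apply]
          have hij : (j : ℕ) < i := hij
          simp only [Fin.succAbove_zero, Fin.succAbove_last, Fin.val_succ, Fin.val_castSucc]
          rw [if_neg (by omega)]
      rw [h3] at h2
      simp only [Fin.val_zero, Fin.val_last, zero_add, Matrix.updateCol_self, Pi.single_eq_same,
        Pi.smul_apply, smul_eq_mul, Nat.sub_self, triangularSol_zero, mul_one] at h2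
      have h4 : ((-1 : K) ^ n) ≠ 0 := pow_ne_zero _ (by simp)
      rw [Finset.prod_range_succ]
      refine mul_right_cancel₀ h4 ?_
      rw [← h2]
      ring
    · intro i _ hi
      rw [Matrix.updateCol_self, Pi.single_eq_of_ne hi]
      ring
    · simp

end hessenberg

/-! ### From chains of initial sets to subsets -/

section orderings

variable {n : ℕ}

/-- The set of the first `m` entries of an ordering. -/
def initialSet (σ : Equiv.Perm (Fin n)) (m : ℕ) : Finset (Fin n) :=
  (Finset.univ.filter (fun l : Fin n => (l : ℕ) < m)).map σ.toEmbedding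

theorem card_initialSet (σ : Equiv.Perm (Fin n)) {m : ℕ} (hm : m ≤ n) :
    (initialSet σ m).card = m := by
  rw [initialSet, Finset.card_map, Fin.card_filter_val_lt, min_eq_right hm]

theorem initialSet_mul_swap (σ : Equiv.Perm (Fin n)) {m : ℕ} {r r' : Fin n} (hr : m ≤ r)
    (hr' : m ≤ r') : initialSet (σ * Equiv.swap r r') m = initialSet σ m := by
  have h (l : Fin n) (hl : (l : ℕ) < m) : (σ * Equiv.swap r r') l = σ l := by
    rw [Equiv.Perm.mul_apply, Equiv.swap_apply_of_ne_of_ne] <;> (rintro rfl; omega)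
  ext a
  simp only [initialSet, Finset.mem_map, Finset.mem_filter, Finset.mem_univ, true_and,
    Equiv.coe_toEmbedding]
  exact exists_congr fun l => and_congr_right fun hl => by rw [h l hl]

theorem initialSet_succ (σ : Equiv.Perm (Fin n)) (r : Fin n) :
    initialSet σ (r + 1) = insert (σ r) (initialSet σ r) := by
  have : Finset.univ.filter (fun l : Fin n => (l : ℕ) < r + 1) =
      insert r (Finset.univ.filter (fun l : Fin n => (l : ℕ) < r)) := by
    ext l
    simp only [Finset.mem_filter, Finset.mem_univ, true_and, Finset.mem_insert, Fin.ext_iff]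
    omega
  rw [initialSet, this, Finset.map_insert]
  rfl

theorem compl_initialSet (σ : Equiv.Perm (Fin n)) (m : ℕ) : (initialSet σ m)ᶜ =
    (Finset.univ.filter (fun l : Fin n => m ≤ (l : ℕ))).map σ.toEmbedding := by
  ext a
  obtain ⟨l, rfl⟩ := σ.surjective a
  simp [initialSet]

variable {K : Type*} [Field K]

/-- Swapping position `m` with any later position changes neither `f` nor the initial set of size
`m`, so the entry at position `m` may be replaced by any of the `n - m` remaining ones. -/
theorem sum_mul_initialSet_succ {m : ℕ} (hm : m < n) {f : Equiv.Perm (Fin n) → K}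
    (hf : ∀ σ (r r' : Fin n), m ≤ r → m ≤ r' → f (σ * Equiv.swap r r') = f σ)
    (ψ : Finset (Fin n) → K) :
    ((n - m : ℕ) : K) * ∑ σ, f σ * ψ (initialSet σ (m + 1)) =
      ∑ σ, f σ * ∑ a ∈ (initialSet σ m)ᶜ, ψ (insert a (initialSet σ m)) := by
  have h1 (r : Fin n) (hr : m ≤ r) : ∑ σ, f σ * ψ (initialSet σ (m + 1)) =
      ∑ σ, f σ * ψ (insert (σ r) (initialSet σ m)) := by
    rw [← Equiv.sum_comp (Equiv.mulRight (Equiv.swap (⟨m, hm⟩ : Fin n) r))]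
    refine Finset.sum_congr rfl fun σ _ => ?_
    have h2 := initialSet_succ (σ * Equiv.swap (⟨m, hm⟩ : Fin n) r) ⟨m, hm⟩
    rw [Equiv.Perm.mul_apply, Equiv.swap_apply_left] at h2
    rw [Equiv.coe_mulRight, hf _ _ _ le_rfl hr, h2, initialSet_mul_swap _ le_rfl hr]
  have h3 : (Finset.univ.filter (fun l : Fin n => m ≤ (l : ℕ))).card = n - m := by
    have := congrArg Finset.card (compl_initialSet (1 : Equiv.Perm (Fin n)) m)
    rw [Finset.card_compl, card_initialSet _ hm.le, Fintype.card_fin, Finset.card_map] at this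
    exact this.symm
  have h4 (σ : Equiv.Perm (Fin n)) : f σ * ∑ a ∈ (initialSet σ m)ᶜ, ψ (insert a (initialSet σ m)) =
      ∑ r ∈ Finset.univ.filter (fun l : Fin n => m ≤ (l : ℕ)),
        f σ * ψ (insert (σ r) (initialSet σ m)) := by
    rw [compl_initialSet, Finset.sum_map, Finset.mul_sum]
    rfl
  simp only [h4]
  rw [Finset.sum_comm, Finset.sum_congr rfl fun r hr => (h1 r (Finset.mem_filter.1 hr).2).symm,
    Finset.sum_const, h3, nsmul_eq_mul]

/-- Double counting: a set of size `m + 1` containing `L` arises by inserting any of its elements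
outside `L`. -/
theorem sum_sum_compl_insert {ι : Type*} [Fintype ι] [DecidableEq ι] (L : Finset ι) (m : ℕ)
    (ψ : Finset ι → K) :
    ∑ N ∈ (Finset.powersetCard m Finset.univ).filter (L ⊆ ·), ∑ a ∈ Nᶜ, ψ (insert a N) =
      ((m + 1 - L.card : ℕ) : K) *
        ∑ N ∈ (Finset.powersetCard (m + 1) Finset.univ).filter (L ⊆ ·), ψ N := by
  have h1 : ((m + 1 - L.card : ℕ) : K) *
      ∑ N ∈ (Finset.powersetCard (m + 1) Finset.univ).filter (L ⊆ ·), ψ N =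
      ∑ N ∈ (Finset.powersetCard (m + 1) Finset.univ).filter (L ⊆ ·), ∑ a ∈ N \ L, ψ N := by
    rw [Finset.mul_sum]
    refine Finset.sum_congr rfl fun N hN => ?_
    simp only [Finset.mem_filter, Finset.mem_powersetCard, Finset.subset_univ, true_and] at hN
    rw [Finset.sum_const, Finset.card_sdiff_of_subset hN.2, hN.1, nsmul_eq_mul]
  rw [h1, Finset.sum_sigma', Finset.sum_sigma']
  refine Finset.sum_bij' (fun x _ => ⟨insert x.2 x.1, x.2⟩) (fun x _ => ⟨x.1.erase x.2, x.2⟩)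
    ?_ ?_ ?_ ?_ ?_
  · rintro ⟨N, a⟩ hN
    simp only [Finset.mem_sigma, Finset.mem_filter, Finset.mem_powersetCard, Finset.subset_univ,
      true_and, Finset.mem_compl, Finset.mem_sdiff] at hN ⊢
    obtain ⟨⟨hN, hL⟩, ha⟩ := hN
    exact ⟨⟨by rw [Finset.card_insert_of_notMem ha, hN], hL.trans (Finset.subset_insert _ _)⟩,
      Finset.mem_insert_self _ _, fun h => ha (hL h)⟩
  · rintro ⟨N, a⟩ hN
    simp only [Finset.mem_sigma, Finset.mem_filter, Finset.mem_powersetCard, Finset.subset_univ,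
      true_and, Finset.mem_compl, Finset.mem_sdiff] at hN ⊢
    obtain ⟨⟨hN, hL⟩, ha, haL⟩ := hN
    exact ⟨⟨by rw [Finset.card_erase_of_mem ha, hN, Nat.add_sub_cancel],
      Finset.subset_erase.2 ⟨hL, haL⟩⟩, Finset.notMem_erase _ _⟩
  · rintro ⟨N, a⟩ hN
    simp only [Finset.mem_sigma, Finset.mem_compl] at hN
    simp only [Finset.erase_insert hN.2]
  · rintro ⟨N, a⟩ hN
    simp only [Finset.mem_sigma, Finset.mem_sdiff] at hN
    simp only [Finset.insert_erase hN.2.1]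
  · rintro ⟨N, a⟩ _
    rfl

variable [CharZero K]

/-- Once the first `l` entries are fixed, the set of the first `m` entries is equidistributed among
the `m`-sets containing them; the factorials express the binomial coefficient `(n - l choose m - l)`
without division. -/
theorem sum_mul_initialSet {l m : ℕ} (hlm : l ≤ m) (hm : m ≤ n) {f : Equiv.Perm (Fin n) → K}
    (hf : ∀ σ (r r' : Fin n), l ≤ r → l ≤ r' → f (σ * Equiv.swap r r') = f σ)
    (ψ : Finset (Fin n) → K) :
    ((n - l).factorial : K) * ∑ σ, f σ * ψ (initialSet σ m) =
      (m - l).factorial * (n - m).factorial * ∑ σ, f σ *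
        ∑ N ∈ (Finset.powersetCard m Finset.univ).filter (initialSet σ l ⊆ ·), ψ N := by
  induction m, hlm using Nat.le_induction generalizing ψ with
  | base =>
    rw [Nat.sub_self, Nat.factorial_zero, Nat.cast_one, one_mul]
    congr 1
    refine Finset.sum_congr rfl fun σ _ => ?_
    have : (Finset.powersetCard l Finset.univ).filter (initialSet σ l ⊆ ·) = {initialSet σ l} := by
      ext N
      simp only [Finset.mem_filter, Finset.mem_powersetCard, Finset.subset_univ, true_and,
        Finset.mem_singleton]
      constructor
      · rintro ⟨h1, h2⟩
        exact (Finset.eq_of_subset_of_card_le h2 (by rw [h1, card_initialSet σ hm])).symm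
      · rintro rfl
        exact ⟨card_initialSet σ hm, subset_rfl⟩
    rw [this, Finset.sum_singleton]
  | succ m hlm ih =>
    have h1 := sum_mul_initialSet_succ (show m < n by omega)
      (fun σ r r' hr hr' => hf σ r r' (hlm.trans hr) (hlm.trans hr')) ψ
    have h2 := ih (by omega) fun N => ∑ a ∈ Nᶜ, ψ (insert a N)
    rw [← h1] at h2
    simp only [sum_sum_compl_insert] at h2
    have h3 : ∑ σ, f σ * (((m + 1 - (initialSet σ l).card : ℕ) : K) *
        ∑ N ∈ (Finset.powersetCard (m + 1) Finset.univ).filter (initialSet σ l ⊆ ·), ψ N) =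
        ((m + 1 - l : ℕ) : K) * ∑ σ, f σ *
          ∑ N ∈ (Finset.powersetCard (m + 1) Finset.univ).filter (initialSet σ l ⊆ ·), ψ N := by
      rw [Finset.mul_sum]
      refine Finset.sum_congr rfl fun σ _ => ?_
      rw [card_initialSet σ (by omega)]
      ring
    rw [h3] at h2
    have hn0 : ((n - m : ℕ) : K) ≠ 0 := Nat.cast_ne_zero.2 (by omega)
    refine mul_left_cancel₀ hn0 ?_
    rw [mul_left_comm, h2, show n - m = (n - (m + 1)) + 1 by omega,
      show m + 1 - l = (m - l) + 1 by omega, Nat.factorial_succ, Nat.factorial_succ]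
    push_cast
    ring

/-- Summing the solutions of the triangular systems attached to all orderings turns a recursion
over chains of initial sets into a recursion over subsets. -/
theorem sum_triangularSol_mul {b : Finset (Fin n) → ℕ → K} {F : Finset (Fin n) → K}
    (hF0 : F ∅ = 1) (hb : ∀ N : Finset (Fin n), N.Nonempty → b N 0 ≠ 0)
    (hF : ∀ N : Finset (Fin n),
      ∑ M ∈ N.powerset, (-1) ^ M.card * b M (N.card - M.card) * F M = 0)
    {m : ℕ} (hm : m ≤ n) (φ : Finset (Fin n) → K) :
    ∑ σ : Equiv.Perm (Fin n),
      triangularSol (fun l k => b (initialSet σ l) k / k.factorial) m * φ (initialSet σ m) =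
      (n - m).factorial * ∑ N ∈ Finset.powersetCard m Finset.univ, F N * φ N := by
  induction m using Nat.strong_induction_on generalizing φ with
  | _ m ih =>
    set V : Equiv.Perm (Fin n) → ℕ → K := fun σ =>
      triangularSol (fun l k => b (initialSet σ l) k / k.factorial) with hV
    have hVinv (l : ℕ) (σ : Equiv.Perm (Fin n)) (r r' : Fin n) (hr : l ≤ r) (hr' : l ≤ r') :
        V (σ * Equiv.swap r r') l = V σ l := by
      refine triangularSol_congr fun l' hl' => ?_
      funext k
      rw [initialSet_mul_swap σ (hl'.trans hr) (hl'.trans hr')]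
    cases m with
    | zero =>
      have h1 (σ : Equiv.Perm (Fin n)) : V σ 0 = 1 := triangularSol_zero _
      have h2 (σ : Equiv.Perm (Fin n)) : initialSet σ 0 = ∅ := by
        rw [← Finset.card_eq_zero, card_initialSet σ hm]
      change ∑ σ, V σ 0 * φ (initialSet σ 0) = _
      simp only [h1, h2, Finset.powersetCard_zero, Finset.sum_singleton, hF0, Finset.sum_const,
        Finset.card_univ, Fintype.card_perm, Fintype.card_fin, nsmul_eq_mul, Nat.sub_zero, one_mul]
    | succ m =>
      -- The divisor in the recursion depends only on the initial set, so it can be absorbed into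
      -- the test function; this is why the induction is over arbitrary `φ`.
      let φ' : Finset (Fin n) → K := fun N => φ N / b N 0
      have h1 (σ : Equiv.Perm (Fin n)) : V σ (m + 1) * φ (initialSet σ (m + 1)) =
          ∑ l ∈ Finset.range (m + 1), (-1) ^ (m - l) / ((m + 1 - l).factorial : K) *
            (b (initialSet σ l) (m + 1 - l) * V σ l * φ' (initialSet σ (m + 1))) := by
        simp only [hV, φ']
        rw [triangularSol_succ, Nat.factorial_zero, Nat.cast_one, div_one, div_mul_comm, mul_comm,
          Finset.sum_mul]
        refine Finset.sum_congr rfl fun l _ => ?_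
        ring
      have h2 (l : ℕ) (hl : l ∈ Finset.range (m + 1)) :
          ∑ σ, (-1) ^ (m - l) / ((m + 1 - l).factorial : K) *
            (b (initialSet σ l) (m + 1 - l) * V σ l * φ' (initialSet σ (m + 1))) =
          (n - (m + 1)).factorial * ∑ N ∈ Finset.powersetCard (m + 1) Finset.univ, φ' N *
            ∑ L ∈ Finset.powersetCard l N, (-1) ^ (m - l) * b L (m + 1 - l) * F L := by
        have hl := Finset.mem_range.1 hl
        have h3 := sum_mul_initialSet (l := l) (by omega) hm
          (f := fun σ => b (initialSet σ l) (m + 1 - l) * V σ l)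
          (fun σ r r' hr hr' => by rw [hVinv l σ r r' hr hr', initialSet_mul_swap σ hr hr']) φ'
        -- The sum over the larger sets `N` is itself a function of the initial set of size `l`,
        -- hence an admissible test function.
        have h4 := ih l (by omega) (by omega) fun L => b L (m + 1 - l) *
          ∑ N ∈ (Finset.powersetCard (m + 1) Finset.univ).filter (L ⊆ ·), φ' N
        have h5 : ∑ L ∈ Finset.powersetCard l Finset.univ, F L * (b L (m + 1 - l) *
            ∑ N ∈ (Finset.powersetCard (m + 1) Finset.univ).filter (L ⊆ ·), φ' N) =
            ∑ N ∈ Finset.powersetCard (m + 1) Finset.univ, φ' N *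
              ∑ L ∈ Finset.powersetCard l N, b L (m + 1 - l) * F L := by
          simp only [Finset.mul_sum]
          rw [Finset.sum_comm' (t' := Finset.powersetCard (m + 1) Finset.univ)
            (s' := fun N => Finset.powersetCard l N)]
          · refine Finset.sum_congr rfl fun N _ => Finset.sum_congr rfl fun L _ => ?_
            ring
          · intro L N
            simp only [Finset.mem_filter, Finset.mem_powersetCard, Finset.subset_univ, true_and]
            tauto
        have h6 : ((n - l).factorial : K) ≠ 0 := Nat.cast_ne_zero.2 (Nat.factorial_ne_zero _)
        have h7 : ((m + 1 - l).factorial : K) ≠ 0 := Nat.cast_ne_zero.2 (Nat.factorial_ne_zero _)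
        have h8 : ∑ σ, b (initialSet σ l) (m + 1 - l) * V σ l *
            ∑ N ∈ (Finset.powersetCard (m + 1) Finset.univ).filter (initialSet σ l ⊆ ·), φ' N =
            ∑ σ, V σ l * (b (initialSet σ l) (m + 1 - l) *
            ∑ N ∈ (Finset.powersetCard (m + 1) Finset.univ).filter (initialSet σ l ⊆ ·), φ' N) :=
          Finset.sum_congr rfl fun σ _ => by rw [mul_comm (b _ _), mul_assoc]
        have h9 : ∑ N ∈ Finset.powersetCard (m + 1) Finset.univ, φ' N *
            ∑ L ∈ Finset.powersetCard l N, (-1) ^ (m - l) * b L (m + 1 - l) * F L =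
            (-1) ^ (m - l) * ∑ N ∈ Finset.powersetCard (m + 1) Finset.univ, φ' N *
            ∑ L ∈ Finset.powersetCard l N, b L (m + 1 - l) * F L := by
          rw [Finset.mul_sum]
          refine Finset.sum_congr rfl fun N _ => ?_
          simp only [mul_assoc, ← Finset.mul_sum]
          rw [mul_left_comm]
        rw [h8, h4.trans (congrArg _ h5)] at h3
        rw [← Finset.mul_sum, h9]
        refine mul_left_cancel₀ h6 ?_
        rw [mul_left_comm, h3]
        field_simp
      rw [Finset.sum_congr rfl fun σ _ => h1 σ, Finset.sum_comm, Finset.sum_congr rfl h2,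
        ← Finset.mul_sum, Finset.sum_comm]
      congr 1
      refine Finset.sum_congr rfl fun N hN => ?_
      have hN := (Finset.mem_powersetCard.1 hN).2
      have h8 := hF N
      -- The term `M = N` is isolated: it is `± b N 0 * F N`, and the others are the sum just
      -- produced.
      rw [Finset.sum_powerset, hN, Finset.sum_range_succ, ← hN, Finset.powersetCard_self,
        Finset.sum_singleton, Nat.sub_self, hN] at h8
      rw [← Finset.mul_sum]
      have h9 : ∑ l ∈ Finset.range (m + 1), ∑ L ∈ Finset.powersetCard l N,
          (-1) ^ (m - l) * b L (m + 1 - l) * F L = (-1) ^ m * ∑ l ∈ Finset.range (m + 1),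
          ∑ L ∈ Finset.powersetCard l N, (-1) ^ L.card * b L (m + 1 - L.card) * F L := by
        rw [Finset.mul_sum]
        refine Finset.sum_congr rfl fun l hl => ?_
        rw [Finset.mul_sum]
        refine Finset.sum_congr rfl fun L hL => ?_
        rw [(Finset.mem_powersetCard.1 hL).2]
        have hl := Finset.mem_range.1 hl
        obtain ⟨p, rfl⟩ : ∃ p, m = p + l := ⟨m - l, by omega⟩
        rw [Nat.add_sub_cancel, pow_add]
        have : ((-1 : K) ^ l) * (-1) ^ l = 1 := by rw [← mul_pow]; simp
        linear_combination (-(-1) ^ p * b L (p + l + 1 - l) * F L) * this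
      rw [h9, eq_neg_of_add_eq_zero_left h8]
      simp only [φ']
      have h10 : b N 0 ≠ 0 := hb N (Finset.card_pos.1 (by omega))
      have h11 : ((-1 : K) ^ m) * (-1) ^ m = 1 := by rw [← mul_pow]; simp
      rw [pow_succ]
      field_simp
      linear_combination (F N * φ N) * h11

theorem sum_triangularSol {b : Finset (Fin n) → ℕ → K} {F : Finset (Fin n) → K}
    (hF0 : F ∅ = 1) (hb : ∀ N : Finset (Fin n), N.Nonempty → b N 0 ≠ 0)
    (hF : ∀ N : Finset (Fin n),
      ∑ M ∈ N.powerset, (-1) ^ M.card * b M (N.card - M.card) * F M = 0) :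
    ∑ σ : Equiv.Perm (Fin n), triangularSol (fun l k => b (initialSet σ l) k / k.factorial) n =
      F Finset.univ := by
  have h := sum_triangularSol_mul hF0 hb hF le_rfl fun _ => 1
  have hu : Finset.powersetCard n (Finset.univ : Finset (Fin n)) = {Finset.univ} := by
    have := Finset.powersetCard_self (Finset.univ : Finset (Fin n))
    rwa [Finset.card_fin] at this
  rw [hu, Finset.sum_singleton, Nat.sub_self, Nat.factorial_zero, Nat.cast_one, one_mul] at h
  simpa only [mul_one] using h

end orderings

/-! ### Identity theorem for meromorphic functions of several variables -/

section identity

variable {E : Type*} [NormedAddCommGroup E] [NormedSpace ℂ E]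

theorem eqOn_zero_ball {f : E → ℂ} {p y : E} {r : ℝ} (hf : AnalyticOnNhd ℂ f (Metric.ball p r))
    (hy : y ∈ Metric.ball p r) (h : ∀ᶠ x in 𝓝 y, f x = 0) :
    ∀ x ∈ Metric.ball p r, f x = 0 := by
  let _ : NormedSpace ℝ E := NormedSpace.restrictScalars ℝ ℂ E
  exact hf.eqOn_zero_of_preconnected_of_eventuallyEq_zero (convex_ball p r).isPreconnected hy h

/-- The analytic function `g * D - N * h` vanishes on an open piece of a ball, hence on the whole
ball, and dividing by `h` gives the equation wherever `h ≠ 0`. Since `G` is uncontrolled on the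
zeros of `h`, only the closure of the interior of the locus propagates. -/
theorem closure_interior_eq_mem_nhds {G N D g h : E → ℂ} {p : E} (hN : AnalyticAt ℂ N p)
    (hD : AnalyticAt ℂ D p) (hg : AnalyticAt ℂ g p) (hh : AnalyticAt ℂ h p)
    (hh0 : ¬ ∀ᶠ x in 𝓝 p, h x = 0) (hG : ∀ᶠ x in 𝓝 p, h x ≠ 0 → G x = g x / h x)
    (hp : p ∈ closure (interior {x | G x * D x = N x})) :
    closure (interior {x | G x * D x = N x}) ∈ 𝓝 p := by
  obtain ⟨r, hr, hball⟩ := Metric.eventually_nhds_iff_ball.1 (hN.eventually_analyticAt.and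
    (hD.eventually_analyticAt.and (hg.eventually_analyticAt.and
      (hh.eventually_analyticAt.and hG))))
  have hne (z : E) (hz : z ∈ Metric.ball p r) : ∃ᶠ x in 𝓝 z, h x ≠ 0 := by
    intro hz'
    refine hh0 ?_
    filter_upwards [Metric.ball_mem_nhds p hr] with x hx
    refine eqOn_zero_ball (fun x hx => (hball x hx).2.2.2.1) hz ?_ x hx
    filter_upwards [hz'] with x hx using not_not.1 hx
  have hnear (x : E) (hx : x ∈ Metric.ball p r) (hx0 : h x ≠ 0) :
      ∀ᶠ z in 𝓝 x, z ∈ Metric.ball p r ∧ h z ≠ 0 ∧ G z * h z = g z := by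
    filter_upwards [Metric.isOpen_ball.mem_nhds hx,
      (hball x hx).2.2.2.1.continuousAt.eventually_ne hx0] with z hz hz0
    exact ⟨hz, hz0, by rw [(hball z hz).2.2.2.2 hz0, div_mul_cancel₀ _ hz0]⟩
  have hzero : ∀ x ∈ Metric.ball p r, g x * D x - N x * h x = 0 := by
    obtain ⟨y, hy, hyW⟩ := mem_closure_iff.1 hp _ Metric.isOpen_ball (Metric.mem_ball_self hr)
    obtain ⟨x, hx0, hx, hxW⟩ := ((hne y hy).and_eventually
      ((Metric.isOpen_ball.eventually_mem hy).and (isOpen_interior.eventually_mem hyW))).exists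
    refine eqOn_zero_ball (f := fun x => g x * D x - N x * h x) (fun z hz => ?_) hx ?_
    · obtain ⟨h1, h2, h3, h4, -⟩ := hball z hz
      exact (h3.mul h2).sub (h1.mul h4)
    · filter_upwards [hnear x hx hx0, mem_interior_iff_mem_nhds.1 hxW] with z hz hzW
      have hzW : G z * D z = N z := hzW
      rw [← hz.2.2, ← hzW]
      ring
  filter_upwards [Metric.ball_mem_nhds p hr] with z hz
  rw [mem_closure_iff]
  intro o ho hzo
  obtain ⟨x, hx0, hx, hxo⟩ := ((hne z hz).and_eventually
    ((Metric.isOpen_ball.eventually_mem hz).and (ho.eventually_mem hzo))).exists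
  refine ⟨x, hxo, mem_interior_iff_mem_nhds.2 ?_⟩
  filter_upwards [hnear x hx hx0] with w hw
  have h1 := hzero w hw.1
  rw [← hw.2.2] at h1
  refine mul_right_cancel₀ hw.2.1 ?_
  linear_combination h1

/-- Two meromorphic functions on a connected open set, one of them given as a quotient, that agree
on a nonempty open subset agree wherever the first one is analytic. -/
theorem mul_eq_of_eq_on_open {U Ω : Set E} (hU : IsPreconnected U) {G N D : E → ℂ}
    (hN : AnalyticOnNhd ℂ N U) (hD : AnalyticOnNhd ℂ D U)
    (hG : ∀ p ∈ U, ∃ g h : E → ℂ, AnalyticAt ℂ g p ∧ AnalyticAt ℂ h p ∧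
      (¬ ∀ᶠ x in 𝓝 p, h x = 0) ∧ ∀ᶠ x in 𝓝 p, h x ≠ 0 → G x = g x / h x)
    (hΩ : IsOpen Ω) (hΩU : Ω ⊆ U) (hΩ0 : Ω.Nonempty) (hGΩ : ∀ x ∈ Ω, G x * D x = N x)
    {s : E} (hs : s ∈ U) (hGs : AnalyticAt ℂ G s) : G s * D s = N s := by
  set C := closure (interior {x | G x * D x = N x}) with hC
  have hloc : ∀ p ∈ U, p ∈ C → p ∈ interior C := by
    intro p hp hpC
    obtain ⟨g, h, hg, hh, hh0, hGp⟩ := hG p hp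
    exact mem_interior_iff_mem_nhds.2
      (closure_interior_eq_mem_nhds (hN p hp) (hD p hp) hg hh hh0 hGp hpC)
  have hsub : Ω ⊆ interior C :=
    interior_maximal ((interior_maximal hGΩ hΩ).trans subset_closure) hΩ
  -- The interior of `C` is open and relatively closed in `U`, so connectedness spreads it over `U`.
  have hUC : U ⊆ interior C := by
    refine hU.subset_of_closure_inter_subset isOpen_interior ?_ ?_
    · obtain ⟨x, hx⟩ := hΩ0
      exact ⟨x, hΩU hx, hsub hx⟩
    · rintro p ⟨hp, hpU⟩
      refine hloc p hpU ?_
      exact closure_minimal interior_subset isClosed_closure hp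
  have hsC : s ∈ C := interior_subset (hUC hs)
  obtain ⟨r, hr, hball⟩ := Metric.eventually_nhds_iff_ball.1
    ((hN s hs).eventually_analyticAt.and ((hD s hs).eventually_analyticAt.and
      hGs.eventually_analyticAt))
  obtain ⟨y, hy, hyW⟩ := mem_closure_iff.1 hsC _ Metric.isOpen_ball (Metric.mem_ball_self hr)
  refine sub_eq_zero.1 (eqOn_zero_ball (f := fun x => G x * D x - N x) (fun z hz => ?_) hy ?_ s
    (Metric.mem_ball_self hr))
  · obtain ⟨h1, h2, h3⟩ := hball z hz
    exact (h3.mul h2).sub h1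
  · filter_upwards [mem_interior_iff_mem_nhds.1 hyW] with z hz
    exact sub_eq_zero.2 hz

end identity

/-! ### The formula on the convergence domain and its continuation -/

theorem isPreconnected_torus (n : ℕ) : IsPreconnected (torus n) := by
  have : torus n = Set.univ.pi fun _ : Fin n => ({0}ᶜ : Set ℂ) := by
    ext s
    simp [torus]
  rw [this]
  refine isPreconnected_univ_pi fun _ => ?_
  exact (isConnected_compl_singleton_of_one_lt_rank (by simp [Complex.rank_real_complex])
    0).isPreconnected

variable {n : ℕ} {q κ : ℂ} {s : Fin n → ℂ}

theorem isOpen_convDomain : IsOpen (convDomain n q) := by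
  have : convDomain n q = (⋂ k : Fin n, {s | 1 < ‖s k ^ 2‖}) ∩ {s | ‖∏ k, s k ^ 2‖ < ‖q‖⁻¹} := by
    ext s
    simp [convDomain]
  rw [this]
  refine (isOpen_iInter_of_finite fun k => isOpen_lt ?_ ?_).inter (isOpen_lt ?_ ?_) <;> fun_prop

theorem convDomain_nonempty (hq0 : q ≠ 0) (hq1 : ‖q‖ < 1) : (convDomain n q).Nonempty := by
  have hc : ∀ᶠ r : ℝ in 𝓝 1, (r ^ 2) ^ n < ‖q‖⁻¹ := by
    have : ContinuousAt (fun r : ℝ => (r ^ 2) ^ n) 1 := by fun_prop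
    refine this.eventually_lt_const ?_
    simpa using (one_lt_inv₀ (norm_pos_iff.2 hq0)).2 hq1
  obtain ⟨r, hr, hr1⟩ := ((hc.filter_mono nhdsWithin_le_nhds).and
    (self_mem_nhdsWithin (s := Set.Ioi (1 : ℝ)))).exists
  have hr1 : 1 < r := hr1
  have hn : ‖((r : ℂ)) ^ 2‖ = r ^ 2 := by
    rw [norm_pow, Complex.norm_real, Real.norm_of_nonneg (by linarith)]
  refine ⟨fun _ => r, fun _ => ?_, ?_⟩
  · rw [hn]
    nlinarith
  · rw [norm_prod, Finset.prod_const, hn]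
    simpa using hr

theorem one_lt_norm_of_mem_convDomain (hs : s ∈ convDomain n q) (k : Fin n) : 1 < ‖s k‖ := by
  have := hs.1 k
  rw [norm_pow] at this
  by_contra! h
  nlinarith [norm_nonneg (s k)]

theorem prod_norm_sq_mul_lt_one (hq0 : q ≠ 0) (hs : s ∈ convDomain n q) :
    (∏ k, ‖s k‖ ^ 2) * ‖q‖ < 1 := by
  have := hs.2
  rw [norm_prod] at this
  simp only [norm_pow] at this
  rwa [← one_div, lt_div_iff₀ (norm_pos_iff.2 hq0)] at this

theorem convDomain_subset_torus : convDomain n q ⊆ torus n := fun _ hs k =>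
  norm_pos_iff.1 (by linarith [one_lt_norm_of_mem_convDomain hs k])

theorem partialProd_eq (σ : Equiv.Perm (Fin n)) (s : Fin n → ℂ) (m : ℕ) :
    partialProd σ s m = ∏ k ∈ initialSet σ m, s k := by
  rw [partialProd, initialSet, Finset.prod_map]
  rfl

theorem theta_prod_ne_zero (h0 : κ ≠ 0) (h1 : ‖κ‖ < 1) (hκ : κ ^ 8 = q)
    (hs : s ∈ convDomain n q) {N : Finset (Fin n)} (hN : N.Nonempty) :
    theta κ (∏ k ∈ N, s k) ≠ 0 := by
  have hs1 := one_lt_norm_of_mem_convDomain hs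
  have hq0 : q ≠ 0 := hκ ▸ pow_ne_zero 8 h0
  refine theta_ne_zero h0 h1 ?_ ?_
  · rw [norm_prod]
    obtain ⟨k, hk⟩ := hN
    refine (hs1 k).trans_le ?_
    have := Finset.prod_le_prod_of_subset_of_one_le (f := fun k => ‖s k‖)
      (Finset.singleton_subset_iff.2 hk) (fun _ _ => norm_nonneg _) fun k _ _ => (hs1 k).le
    rwa [Finset.prod_singleton] at this
  · rw [norm_prod, ← Finset.prod_pow, hκ]
    exact prod_norm_sq_mul_lt (fun k _ => hs1 k) (prod_norm_sq_mul_lt_one hq0 hs)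
      (Finset.subset_univ N)

theorem thetaDenom_ne_zero (h0 : κ ≠ 0) (h1 : ‖κ‖ < 1) (hκ : κ ^ 8 = q)
    (hs : s ∈ convDomain n q) (σ : Equiv.Perm (Fin n)) : thetaDenom κ s σ ≠ 0 := by
  refine Finset.prod_ne_zero_iff.2 fun m _ => ?_
  rw [partialProd_eq]
  refine theta_prod_ne_zero h0 h1 hκ hs ?_
  rw [← Finset.card_pos, card_initialSet σ (Nat.succ_le_of_lt m.2)]
  omega

theorem corr_eq_thetaSum (h0 : κ ≠ 0) (h1 : ‖κ‖ < 1) (hκ : κ ^ 8 = q)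
    (hs : s ∈ convDomain n q) : corr q s Finset.univ = thetaSum κ s := by
  have hs1 := one_lt_norm_of_mem_convDomain hs
  have hq0 : q ≠ 0 := hκ ▸ pow_ne_zero 8 h0
  have hq1 : ‖q‖ < 1 := by
    rw [← hκ, norm_pow]
    exact pow_lt_one₀ (norm_nonneg _) h1 (by norm_num)
  -- Nonvanishing of `b N 0` is available exactly for nonempty `N`: the empty product gives Θ(1) =
  -- 0.
  rw [← sum_triangularSol (b := fun N k => thetaDeriv κ k (∏ k ∈ N, s k)) (corr_empty hq1)
    (fun N hN => theta_prod_ne_zero h0 h1 hκ hs hN) (fun N => ?_), thetaSum]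
  · refine Finset.sum_congr rfl fun σ _ => ?_
    set a : ℕ → ℕ → ℂ := fun l k =>
      thetaDeriv κ k (∏ k ∈ initialSet σ l, s k) / k.factorial with ha
    have h2 : thetaMatrix κ s σ = hessenberg a n := by
      ext i j
      simp only [thetaMatrix, hessenberg, Matrix.of_apply, partialProd_eq, ha]
    have h3 : thetaDenom κ s σ = ∏ m ∈ Finset.range n, a (m + 1) 0 := by
      simp only [thetaDenom, Finset.prod_range, partialProd_eq, ha, Nat.factorial_zero,
        Nat.cast_one, div_one]
      rfl
    have h4 := thetaDenom_ne_zero h0 h1 hκ hs σ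
    rw [eq_div_iff h4, h2, h3, det_hessenberg]
    intro m hm
    rw [h3] at h4
    exact Finset.prod_ne_zero_iff.1 h4 m (Finset.mem_range.2 hm)
  · exact sum_thetaDeriv_mul_corr h0 h1 hκ (fun k _ => hs1 k)
      (prod_norm_sq_mul_lt (fun k _ => hs1 k) (prod_norm_sq_mul_lt_one hq0 hs)
        (Finset.subset_univ N))

theorem analyticAt_thetaDeriv_partialProd (h0 : κ ≠ 0) (h1 : ‖κ‖ < 1) (σ : Equiv.Perm (Fin n))
    (k m : ℕ) (hs : s ∈ torus n) :
    AnalyticAt ℂ (fun z : Fin n → ℂ => thetaDeriv κ k (partialProd σ z m)) s := by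
  have h2 : AnalyticAt ℂ (fun z : Fin n → ℂ => partialProd σ z m) s := by
    unfold partialProd
    refine Finset.analyticAt_fun_prod _ fun l _ => ?_
    exact (ContinuousLinearMap.proj (R := ℂ) (φ := fun _ : Fin n => ℂ) (σ l)).analyticAt s
  have h3 : partialProd σ s m ≠ 0 := Finset.prod_ne_zero_iff.2 fun l _ => hs (σ l)
  exact AnalyticAt.comp (g := thetaDeriv κ k) (analyticAt_thetaDeriv h0 h1 k h3) h2

theorem analyticAt_thetaDenom (h0 : κ ≠ 0) (h1 : ‖κ‖ < 1) (σ : Equiv.Perm (Fin n))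
    (hs : s ∈ torus n) : AnalyticAt ℂ (fun z : Fin n → ℂ => thetaDenom κ z σ) s := by
  unfold thetaDenom
  exact Finset.analyticAt_fun_prod _ fun m _ =>
    analyticAt_thetaDeriv_partialProd h0 h1 σ 0 (m + 1) hs

theorem analyticAt_det_thetaMatrix (h0 : κ ≠ 0) (h1 : ‖κ‖ < 1) (σ : Equiv.Perm (Fin n))
    (hs : s ∈ torus n) : AnalyticAt ℂ (fun z : Fin n → ℂ => (thetaMatrix κ z σ).det) s := by
  simp only [Matrix.det_apply']
  refine Finset.analyticAt_fun_sum _ fun τ _ => analyticAt_const.mul ?_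
  refine Finset.analyticAt_fun_prod _ fun j _ => ?_
  simp only [thetaMatrix, Matrix.of_apply]
  split_ifs
  · exact (analyticAt_thetaDeriv_partialProd h0 h1 σ _ _ hs).div_const
  · exact analyticAt_const

/-- The common denominator of `thetaSum`. -/
def commonDenom (κ : ℂ) (s : Fin n → ℂ) : ℂ := ∏ σ : Equiv.Perm (Fin n), thetaDenom κ s σ

/-- The numerator of `thetaSum` over the common denominator. -/
def commonNum (κ : ℂ) (s : Fin n → ℂ) : ℂ :=
  ∑ σ : Equiv.Perm (Fin n), (thetaMatrix κ s σ).det * ∏ τ ∈ Finset.univ.erase σ, thetaDenom κ s τ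

theorem thetaSum_eq_div (h : commonDenom κ s ≠ 0) :
    thetaSum κ s = commonNum κ s / commonDenom κ s := by
  rw [thetaSum, commonNum, Finset.sum_div]
  refine Finset.sum_congr rfl fun σ _ => ?_
  have h2 : thetaDenom κ s σ ≠ 0 := Finset.prod_ne_zero_iff.1 h σ (Finset.mem_univ σ)
  have h3 := Finset.mul_prod_erase Finset.univ (thetaDenom κ s) (Finset.mem_univ σ)
  rw [div_eq_div_iff h2 h, commonDenom, ← h3]
  ring

theorem analyticAt_commonDenom (h0 : κ ≠ 0) (h1 : ‖κ‖ < 1) (hs : s ∈ torus n) :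
    AnalyticAt ℂ (commonDenom κ : (Fin n → ℂ) → ℂ) s := by
  unfold commonDenom
  exact Finset.analyticAt_fun_prod _ fun σ _ => analyticAt_thetaDenom h0 h1 σ hs

theorem analyticAt_commonNum (h0 : κ ≠ 0) (h1 : ‖κ‖ < 1) (hs : s ∈ torus n) :
    AnalyticAt ℂ (commonNum κ : (Fin n → ℂ) → ℂ) s := by
  unfold commonNum
  exact Finset.analyticAt_fun_sum _ fun σ _ => (analyticAt_det_thetaMatrix h0 h1 σ hs).mul
    (Finset.analyticAt_fun_prod _ fun τ _ => analyticAt_thetaDenom h0 h1 τ hs)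

/-- Vanishing near one point would spread over the connected torus, contradicting nonvanishing on
the nonempty convergence domain. -/
theorem not_eventually_commonDenom_eq_zero (h0 : κ ≠ 0) (h1 : ‖κ‖ < 1) (hs : s ∈ torus n) :
    ¬ ∀ᶠ z in 𝓝 s, commonDenom κ z = 0 := by
  intro h
  have h2 : AnalyticOnNhd ℂ (commonDenom κ : (Fin n → ℂ) → ℂ) (torus n) :=
    fun z hz => analyticAt_commonDenom h0 h1 hz
  have h3 := h2.eqOn_zero_of_preconnected_of_eventuallyEq_zero (isPreconnected_torus n) hs h
  have hq1 : ‖κ ^ 8‖ < 1 := by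
    rw [norm_pow]
    exact pow_lt_one₀ (norm_nonneg _) h1 (by norm_num)
  obtain ⟨z, hz⟩ := convDomain_nonempty (n := n) (pow_ne_zero 8 h0) hq1
  exact Finset.prod_ne_zero_iff.2 (fun σ _ => thetaDenom_ne_zero h0 h1 rfl hz σ)
    (h3 (convDomain_subset_torus hz))

end BlochOkounkov

end

theorem theorem3 (n : ℕ) (hn : 1 ≤ n) (q κ : ℂ) (hq0 : q ≠ 0) (hq1 : ‖q‖ < 1) (hκ : κ ^ 8 = q) :
    -- on the domain of convergence all series converge, no denominator vanishes,
    -- and the formula holds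
    (∀ s ∈ BlochOkounkov.convDomain n q,
      (∀ (k : Fin n) (lam : YoungDiagram), Summable (BlochOkounkov.rowTerm (s k) lam)) ∧
      Summable (BlochOkounkov.avgTerm q (BlochOkounkov.nPointFun s)) ∧
      (∀ σ : Equiv.Perm (Fin n), BlochOkounkov.thetaDenom κ s σ ≠ 0) ∧
      BlochOkounkov.nPoint q s = BlochOkounkov.thetaSum κ s) ∧
    -- the right-hand side is a meromorphic continuation of the left-hand side
    BlochOkounkov.IsMeromorphicOn (n := n) (BlochOkounkov.thetaSum κ) (BlochOkounkov.torus n) ∧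
    -- and every meromorphic continuation is given by the formula
    (∀ G : (Fin n → ℂ) → ℂ, BlochOkounkov.IsMeromorphicOn G (BlochOkounkov.torus n) →
      (∀ s ∈ BlochOkounkov.convDomain n q, G s = BlochOkounkov.nPoint q s) →
      ∀ s ∈ BlochOkounkov.torus n, AnalyticAt ℂ G s →
        (∀ σ : Equiv.Perm (Fin n), BlochOkounkov.thetaDenom κ s σ ≠ 0) →
        G s = BlochOkounkov.thetaSum κ s) := by
  open BlochOkounkov in
  have h0 : κ ≠ 0 := by
    rintro rfl
    exact hq0 (by rw [← hκ, zero_pow (by norm_num)])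
  have h1 : ‖κ‖ < 1 := by
    rw [← hκ, norm_pow] at hq1
    exact (pow_lt_one_iff_of_nonneg (norm_nonneg _) (by norm_num)).1 hq1
  have hformula (s : Fin n → ℂ) (hs : s ∈ convDomain n q) : nPoint q s = thetaSum κ s :=
    corr_eq_thetaSum h0 h1 hκ hs
  refine ⟨fun s hs => ?_, fun p hp => ?_, fun G hG hGs s hs hGan hden => ?_⟩
  · have hs1 := one_lt_norm_of_mem_convDomain hs
    exact ⟨fun k lam => summable_rowTerm (hs1 k) lam,
      (summable_norm_prod_rowSum hq1 (fun k _ => hs1 k) (prod_norm_sq_mul_lt_one hq0 hs)).of_norm,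
      thetaDenom_ne_zero h0 h1 hκ hs, hformula s hs⟩
  · exact ⟨commonNum κ, commonDenom κ, analyticAt_commonNum h0 h1 hp,
      analyticAt_commonDenom h0 h1 hp, not_eventually_commonDenom_eq_zero h0 h1 hp,
      Filter.Eventually.of_forall fun x hx => thetaSum_eq_div hx⟩
  -- Clearing the common denominator puts the comparison in the form of the identity theorem, with
  -- numerator and denominator analytic on the whole torus.
  · have hdom (x : Fin n → ℂ) (hx : x ∈ convDomain n q) :
        G x * commonDenom κ x = commonNum κ x := by
      have hne : commonDenom κ x ≠ 0 :=
        Finset.prod_ne_zero_iff.2 fun σ _ => thetaDenom_ne_zero h0 h1 hκ hx σ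
      rw [hGs x hx, hformula x hx, thetaSum_eq_div hne, div_mul_cancel₀ _ hne]
    have hne : commonDenom κ s ≠ 0 := Finset.prod_ne_zero_iff.2 fun σ _ => hden σ
    rw [thetaSum_eq_div hne, eq_div_iff hne]
    exact mul_eq_of_eq_on_open (isPreconnected_torus n)
      (fun z hz => analyticAt_commonNum h0 h1 hz) (fun z hz => analyticAt_commonDenom h0 h1 hz)
      hG isOpen_convDomain convDomain_subset_torus (convDomain_nonempty hq0 hq1) hdom hs hGan
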